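/- Let $\mathcal L$ be the two-sorted language with number variables, variables for functions $\mathbb N^n\to\mathbb N$ of every arity $n$, the order $<$, and a symbol for every primitive recursive function (in particular $0$ and the successor $s$). The theory $\mathsf{PRA}^2$ has as axioms: $s(x)\neq 0$ and injectivity of $s$; the recursive definition of $<$; the defining equations of all primitive recursive functions; induction for quantifier-free formulae with number and function parameters; and the axioms saying that the functions contain the primitive recursive ones and the constants and are closed under composition and primitive recursion. Let $\mathsf{QF}\text{-}\mathsf{AC}$ be the schema $\forall n\,\exists m\,\theta(n,m)\rightarrow\exists f\,\forall n\,\theta(n,f(n))$ for quantifier-free $\theta$ (with number and function parameters), and let $\mathsf{RCA}_0$ be $\mathsf{PRA}^2+\mathsf{QF}\text{-}\mathsf{AC}$. For standard $n,k\ge 1$ let $\mathsf{RT}^n_k$ be the sentence: for every colouring $c$ of the $n$-element sets of numbers (given as a function on increasing $n$-tuples) with colours less than $k$, there is a $\{0,1\}$-valued function which is the characteristic function of an infinite (that is, unbounded) set $H$ such that $c$ is constant on the $n$-element subsets of $H$. Let $\mathsf{RT}^1_{<\infty}$ be the sentence saying the same for $n=1$ and for all numbers $k$, where $k$ is quantified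 inside the theory. Say that a theory $S$ implies a theory $T$ over $\mathsf{PRA}^2$ if every model $(M,\mathcal X)$ of $\mathsf{PRA}^2+S$ (where $M$ may be non-standard and the function variables range over a set $\mathcal X$ of functions on $M$) is a model of $T$; equivalently, if $\mathsf{PRA}^2+S$ proves $T$. Then, over $\mathsf{PRA}^2$: 1. $\mathsf{RT}^1_{<\infty}$ does not imply $\mathsf{RCA}_0$, and $\mathsf{RCA}_0$ does not imply $\mathsf{RT}^1_{<\infty}$; 2. for all $n,k\ge 2$, $\mathsf{RT}^n_k$ does not imply $\mathsf{RCA}_0$, and $\mathsf{RCA}_0$ does not imply $\mathsf{RT}^n_k$. That is, each of these principles is incomparable with $\mathsf{RCA}_0$ over $\mathsf{PRA}^2$. -/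

import Mathlib

namespace SecondOrderPRA

/-- Primitive recursive definitions of `n`-ary functions. Each of them is a function symbol of the
language; the constant `0` and the successor `s` are the symbols `zero` and `succ`. -/
inductive PRSymbol : ℕ → Type
  | zero : PRSymbol 0
  | succ : PRSymbol 1
  | proj {n : ℕ} (i : Fin n) : PRSymbol n
  | comp {m n : ℕ} (f : PRSymbol m) (g : Fin m → PRSymbol n) : PRSymbol n
  | prec {n : ℕ} (f : PRSymbol n) (g : PRSymbol (n + 2)) : PRSymbol (n + 1)

/-- Terms of the number sort. Number variables are named by natural numbers, and for each arity `n`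
the function variables of arity `n` are named by natural numbers. -/
inductive Term : Type
  | var (i : ℕ) : Term
  | sym {n : ℕ} (p : PRSymbol n) (t : Fin n → Term) : Term
  | app (n : ℕ) (f : ℕ) (t : Fin n → Term) : Term

namespace Term

def zero : Term := sym PRSymbol.zero Fin.elim0

def succ (t : Term) : Term := sym PRSymbol.succ (fun _ => t)

/-- The numeral `s (s (... 0))`. -/
def numeral : ℕ → Term
  | 0 => zero
  | k + 1 => succ (numeral k)

/-- The tuple of variables `x₀, ..., xₙ₋₁`. -/
def vars (n : ℕ) : Fin n → Term := fun j => var j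

/-- Substitution of the term `u` for the number variable `i`: `t.subst i u` is `t[u/i]`. -/
def subst : Term → ℕ → Term → Term
  | var j, i, u => if j = i then u else var j
  | sym p t, i, u => sym p (fun j => (t j).subst i u)
  | app n f t, i, u => app n f (fun j => (t j).subst i u)

/-- The function variable `f` of arity `n` does not occur in the term. -/
def FreshFun (n f : ℕ) : Term → Prop
  | var _ => True
  | sym _ t => ∀ j, FreshFun n f (t j)
  | app m g t => ¬ (m = n ∧ g = f) ∧ ∀ j, FreshFun n f (t j)

end Term

/-- Quantifier-free formulae. -/
inductive QF : Type
  | eq (t u : Term) : QF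
  | lt (t u : Term) : QF
  | neg (θ : QF) : QF
  | and (θ η : QF) : QF
  | or (θ η : QF) : QF
  | imp (θ η : QF) : QF

namespace QF

/-- Substitution of the term `u` for the number variable `i`: `θ.subst i u` is `θ[u/i]`. -/
def subst : QF → ℕ → Term → QF
  | eq t t', i, u => eq (t.subst i u) (t'.subst i u)
  | lt t t', i, u => lt (t.subst i u) (t'.subst i u)
  | neg θ, i, u => neg (θ.subst i u)
  | and θ η, i, u => and (θ.subst i u) (η.subst i u)
  | or θ η, i, u => or (θ.subst i u) (η.subst i u)
  | imp θ η, i, u => imp (θ.subst i u) (η.subst i u)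

/-- The function variable `f` of arity `n` does not occur in the formula. -/
def FreshFun (n f : ℕ) : QF → Prop
  | eq t u => t.FreshFun n f ∧ u.FreshFun n f
  | lt t u => t.FreshFun n f ∧ u.FreshFun n f
  | neg θ => θ.FreshFun n f
  | and θ η => θ.FreshFun n f ∧ η.FreshFun n f
  | or θ η => θ.FreshFun n f ∧ η.FreshFun n f
  | imp θ η => θ.FreshFun n f ∧ η.FreshFun n f

/-- Finite conjunctions (the empty one is `0 = 0`). -/
def conj : List QF → QF
  | [] => eq Term.zero Term.zero
  | θ :: l => and θ (conj l)

end QF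

/-- Formulae of the two-sorted language: quantifiers range over numbers and over functions of each
arity. -/
inductive Formula : Type
  | qf (θ : QF) : Formula
  | neg (φ : Formula) : Formula
  | and (φ ψ : Formula) : Formula
  | or (φ ψ : Formula) : Formula
  | imp (φ ψ : Formula) : Formula
  | allNum (i : ℕ) (φ : Formula) : Formula
  | exNum (i : ℕ) (φ : Formula) : Formula
  | allFun (n f : ℕ) (φ : Formula) : Formula
  | exFun (n f : ℕ) (φ : Formula) : Formula

/-- The block of quantifiers `∀ x₀ ... ∀ xₙ₋₁`. -/
def Formula.allNums (n : ℕ) (φ : Formula) : Formula :=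
  (List.range n).foldr Formula.allNum φ

/-- A structure `(M, 𝒳)`: the number sort is `carrier`, and function variables of arity `n` range
over the set `Fun n` of `n`-ary functions on it. As usual, both sorts are non-empty (for the number
sort, this follows from the presence of the constant `0`). -/
structure Model where
  carrier : Type
  sym : ∀ {n : ℕ}, PRSymbol n → (Fin n → carrier) → carrier
  lt : carrier → carrier → Prop
  Fun : ∀ n : ℕ, Set ((Fin n → carrier) → carrier)
  fun_nonempty : ∀ n : ℕ, (Fun n).Nonempty

/-- An assignment of values to all number variables and function variables. -/
structure Assignment (M : Model) where
  num : ℕ → M.carrier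
  func : ∀ n : ℕ, ℕ → M.Fun n

namespace Assignment

def setNum {M : Model} (v : Assignment M) (i : ℕ) (a : M.carrier) : Assignment M where
  num := Function.update v.num i a
  func := v.func

def setFun {M : Model} (v : Assignment M) (n f : ℕ) (F : M.Fun n) : Assignment M where
  num := v.num
  func := Function.update v.func n (Function.update (v.func n) f F)

end Assignment

def Term.eval {M : Model} (v : Assignment M) : Term → M.carrier
  | var i => v.num i
  | sym p t => M.sym p (fun j => eval v (t j))
  | app n f t => (v.func n f).1 (fun j => eval v (t j))

def QF.Holds {M : Model} (v : Assignment M) : QF → Prop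
  | eq t u => t.eval v = u.eval v
  | lt t u => M.lt (t.eval v) (u.eval v)
  | neg θ => ¬ θ.Holds v
  | and θ η => θ.Holds v ∧ η.Holds v
  | or θ η => θ.Holds v ∨ η.Holds v
  | imp θ η => θ.Holds v → η.Holds v

def Formula.Holds {M : Model} : Assignment M → Formula → Prop
  | v, qf θ => θ.Holds v
  | v, neg φ => ¬ φ.Holds v
  | v, and φ ψ => φ.Holds v ∧ ψ.Holds v
  | v, or φ ψ => φ.Holds v ∨ ψ.Holds v
  | v, imp φ ψ => φ.Holds v → ψ.Holds v
  | v, allNum i φ => ∀ a : M.carrier, φ.Holds (v.setNum i a)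
  | v, exNum i φ => ∃ a : M.carrier, φ.Holds (v.setNum i a)
  | v, allFun n f φ => ∀ F : M.Fun n, φ.Holds (v.setFun n f F)
  | v, exFun n f φ => ∃ F : M.Fun n, φ.Holds (v.setFun n f F)

/-- A theory is a set of formulae; a formula with free variables stands for its universal
closure. -/
abbrev Theory := Set Formula

def Model.Satisfies (M : Model) (T : Theory) : Prop :=
  ∀ φ ∈ T, ∀ v : Assignment M, φ.Holds v

/-- Over the base theory `B`, the theory `S` implies the theory `T`: every model of `B` and `S` is
a model of `T`. (By the completeness theorem for the two-sorted predicate calculus, this says that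
`B + S` proves every member of `T`. The language is countable, so that models in `Type` suffice.) -/
def ImpliesOver (B S T : Theory) : Prop :=
  ∀ M : Model, M.Satisfies B → M.Satisfies S → M.Satisfies T

open Term

/-- The axioms of second-order primitive recursive arithmetic. -/
inductive PRA2Axiom : Formula → Prop
  -- `0 ≠ s x`
  | zero_ne_succ : PRA2Axiom (.qf (.neg (.eq zero (succ (var 0)))))
  -- `s x = s y → x = y`
  | succ_inj : PRA2Axiom (.qf (.imp (.eq (succ (var 0)) (succ (var 1))) (.eq (var 0) (var 1))))
  -- the recursive definition of the order: `¬ x < 0`, and `x < s y ↔ x < y ∨ x = y`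
  | not_lt_zero : PRA2Axiom (.qf (.neg (.lt (var 0) zero)))
  | lt_succ : PRA2Axiom (.qf (.and
      (.imp (.lt (var 0) (succ (var 1))) (.or (.lt (var 0) (var 1)) (.eq (var 0) (var 1))))
      (.imp (.or (.lt (var 0) (var 1)) (.eq (var 0) (var 1))) (.lt (var 0) (succ (var 1))))))
  -- the defining equations of the primitive recursive functions
  | proj_def {n : ℕ} (i : Fin n) : PRA2Axiom (.qf (.eq (sym (.proj i) (vars n)) (var i)))
  | comp_def {m n : ℕ} (f : PRSymbol m) (g : Fin m → PRSymbol n) :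
      PRA2Axiom (.qf (.eq (sym (.comp f g) (vars n)) (sym f (fun j => sym (g j) (vars n)))))
  | prec_zero_def {n : ℕ} (f : PRSymbol n) (g : PRSymbol (n + 2)) :
      PRA2Axiom (.qf (.eq (sym (.prec f g) (Fin.cons zero (vars n))) (sym f (vars n))))
  | prec_succ_def {n : ℕ} (f : PRSymbol n) (g : PRSymbol (n + 2)) :
      PRA2Axiom (.qf (.eq (sym (.prec f g) (Fin.cons (succ (var n)) (vars n)))
        (sym g (Fin.cons (var n)
          (Fin.cons (sym (.prec f g) (Fin.cons (var n) (vars n))) (vars n))))))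
  -- quantifier-free induction, with number and function parameters
  | induction (θ : QF) (i : ℕ) :
      PRA2Axiom (.imp
        (.and (.qf (θ.subst i zero)) (.allNum i (.qf (.imp θ (θ.subst i (succ (var i)))))))
        (.allNum i (.qf θ)))
  -- every primitive recursive functional can be applied to all functions and number parameters:
  -- the functions contain the primitive recursive ones and the constant ones, and they are closed
  -- under composition and primitive recursion
  | fun_sym {n : ℕ} (p : PRSymbol n) :
      PRA2Axiom (.exFun n 0 (.allNums n (.qf (.eq (app n 0 (vars n)) (sym p (vars n))))))
  | fun_const (n : ℕ) :
      PRA2Axiom (.exFun n 0 (.allNums n (.qf (.eq (app n 0 (vars n)) (var n)))))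
  -- here `f` is the function variable `0` of arity `m`, and `g₀, ..., gₘ₋₁` are the function
  -- variables `1, ..., m` of arity `n`
  | fun_comp (m n : ℕ) :
      PRA2Axiom (.exFun n (m + 1) (.allNums n (.qf (.eq (app n (m + 1) (vars n))
        (app m 0 (fun j => app n (j + 1) (vars n)))))))
  -- here `f` is the function variable `0` of arity `n`, and `g` is the function variable `1` of
  -- arity `n + 2`
  | fun_prec (n : ℕ) :
      PRA2Axiom (.exFun (n + 1) 2 (.and
        (.allNums n (.qf (.eq (app (n + 1) 2 (Fin.cons zero (vars n))) (app n 0 (vars n)))))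
        (.allNums (n + 1) (.qf (.eq (app (n + 1) 2 (Fin.cons (succ (var n)) (vars n)))
          (app (n + 2) 1 (Fin.cons (var n)
            (Fin.cons (app (n + 1) 2 (Fin.cons (var n) (vars n))) (vars n)))))))))

/-- The theory `PRA²`. -/
def PRA2 : Theory := {φ | PRA2Axiom φ}

/-- The quantifier-free axiom of choice: `∀ n ∃ m θ(n, m) → ∃ f ∀ n θ(n, f(n))` for quantifier-free
`θ`, with number and function parameters. Here `n` and `m` are the distinct number variables `i`
and `j`. -/
def QFAC : Theory :=
  {φ | ∃ (θ : QF) (i j f : ℕ), i ≠ j ∧ θ.FreshFun 1 f ∧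
    φ = .imp (.allNum i (.exNum j (.qf θ)))
      (.exFun 1 f (.allNum i (.qf (θ.subst j (app 1 f (fun _ => var i))))))}

/-- `RCA₀` in the language of functions, that is, `PRA² + QF-AC`. -/
def RCA0 : Theory := PRA2 ∪ QFAC

/-- `x₀ < x₁ < ... < xₙ₋₁`. -/
def increasing (n : ℕ) : QF :=
  QF.conj ((List.range (n - 1)).map (fun j => QF.lt (var j) (var (j + 1))))

/-- The number `t` belongs to the set whose characteristic function is the unary function
variable `1`. -/
def mem (t : Term) : QF := QF.eq (app 1 1 (fun _ => t)) (numeral 1)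

/-- Every colouring of the `n`-element sets of numbers by the colours less than `k` has an infinite
(that is, unbounded) homogeneous set. The colouring is the function variable `0` of arity `n`, on
increasing `n`-tuples; the homogeneous set is given by its characteristic function, the function
variable `1` of arity `1`; the colour of its `n`-element subsets is the number variable `n`. -/
def ramseyFor (n : ℕ) (k : Term) : Formula :=
  .allFun n 0 (.imp
    (.allNums n (.qf (.imp (increasing n) (.lt (app n 0 (vars n)) k))))
    (.exFun 1 1 (.and
      (.allNum 0 (.qf (.or (.eq (app 1 1 (fun _ => var 0)) (numeral 0))
        (.eq (app 1 1 (fun _ => var 0)) (numeral 1)))))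
      (.and
        (.allNum 0 (.exNum 1 (.qf (.and (.lt (var 0) (var 1)) (mem (var 1))))))
        (.exNum n (.allNums n (.qf (.imp
          (.and (increasing n) (QF.conj ((List.range n).map (fun j => mem (var j)))))
          (.eq (app n 0 (vars n)) (var n))))))))))

/-- Ramsey's theorem `RT^n_k` for `n`-element sets and `k` colours, where `n` and `k` are
standard. -/
def RT (n k : ℕ) : Theory := {ramseyFor n (numeral k)}

/-- The infinite pigeonhole principle `RT^1_{<∞}`: the number of colours is quantified inside the
theory, by the number variable `2`. -/
def RT1Fin : Theory := {.allNum 2 (ramseyFor 1 (var 2))}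

end SecondOrderPRA

/-! Each non-implication is witnessed by one model, and the same two models serve for every `n` and
`k`.

Ramsey principles without `QF-AC`: take the standard numbers with all functions majorized by a
primitive recursive function (`majorizedModel`). Majorization is preserved by composition and
primitive recursion, so `PRA²` holds. Every `{0,1}`-valued function is present, so Ramsey's theorem
is inherited from the true infinite one. The graph of the diagonal Ackermann function is present
too, but not the function itself, and choice would produce it from its graph.

`RCA₀` without the Ramsey principles: the model (`genModel`) must have `Σ₁` induction but fail `Σ₂`
collection. Let `stageLim j a` be the `j`-fold iterate, from `a`, of a map that passes from `x` to a
bound on the halting times of the programs below `x` on inputs below `x`. In an ultrapower of `ℕ`,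
the numbers of the model are the sequences that are almost everywhere a fixed partial recursive
function of `stageLim j n`, for some standard `j`. The functions of the model are the partial
recursive ones, with such sequences as parameters, that are defined at all these arguments. Since
one more iteration bounds halting times, undefinedness below a bound becomes decidable. Hence a
partial recursive function undefined somewhere below a bound has a least such argument in the model
(`Gen.exists_least_undefined`). This gives primitive recursion, induction and choice by least
witnesses.

Each number of the model has a standard index (a program and a `j`), and its value is the limit of a
primitive recursive approximation that has settled at some stage of the model. Let `N` be the class
of the identity sequence. Colour a stage by a number up to `N` that differs from the first `N`
approximations at that stage. All standard indices are below `N`, so each colour occurs only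
boundedly often (`exists_bound_genColour`), which refutes `RT1Fin`. For exponent at least 2, colour
a tuple by whether its first two entries have equal colours. An unbounded set in the model contains
two numbers of equal colour (`exists_lt_genColour_eq`), so on a homogeneous set all colours agree,
and again one colour would be unbounded. -/

namespace SecondOrderPRA

/-! ### Semantics: assignments, quantifier blocks and substitution -/

namespace Assignment

variable {M : Model}

/-- Reassign the number variables `x₀, ..., xₙ₋₁`. -/
def setNums (v : Assignment M) {n : ℕ} (x : Fin n → M.carrier) : Assignment M where
  num := fun i => if h : i < n then x ⟨i, h⟩ else v.num i
  func := v.func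

@[simp] lemma setNum_num_self (v : Assignment M) (i : ℕ) (a : M.carrier) :
    (v.setNum i a).num i = a := by simp [setNum]

lemma setNum_num_of_ne (v : Assignment M) {i j : ℕ} (h : j ≠ i) (a : M.carrier) :
    (v.setNum i a).num j = v.num j := by simp [setNum, h]

lemma setNum_num (v : Assignment M) (i j : ℕ) (a : M.carrier) :
    (v.setNum i a).num j = if j = i then a else v.num j := by
  simp [setNum, Function.update_apply]

@[simp] lemma setNum_func (v : Assignment M) (i : ℕ) (a : M.carrier) :
    (v.setNum i a).func = v.func := rfl

@[simp] lemma setFun_num (v : Assignment M) (n f : ℕ) (F : M.Fun n) :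
    (v.setFun n f F).num = v.num := rfl

@[simp] lemma setFun_func_self (v : Assignment M) (n f : ℕ) (F : M.Fun n) :
    (v.setFun n f F).func n f = F := by simp [setFun]

lemma setFun_func_of_ne (v : Assignment M) {n f g : ℕ} (h : g ≠ f) (F : M.Fun n) :
    (v.setFun n f F).func n g = v.func n g := by simp [setFun, h]

lemma setFun_func_of_arity_ne (v : Assignment M) {n m f : ℕ} (h : m ≠ n) (F : M.Fun n) :
    (v.setFun n f F).func m = v.func m := by simp [setFun, h]

lemma setNum_self (v : Assignment M) (i : ℕ) : v.setNum i (v.num i) = v := by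
  simp [setNum]

lemma setNum_setNum (v : Assignment M) (i : ℕ) (a b : M.carrier) :
    (v.setNum i a).setNum i b = v.setNum i b := by
  simp [setNum]

lemma setNum_setFun (v : Assignment M) (i : ℕ) (a : M.carrier) (n f : ℕ) (F : M.Fun n) :
    (v.setFun n f F).setNum i a = (v.setNum i a).setFun n f F := rfl

@[simp] lemma setNums_func (v : Assignment M) {n : ℕ} (x : Fin n → M.carrier) :
    (v.setNums x).func = v.func := rfl

@[simp] lemma setNums_num_fin (v : Assignment M) {n : ℕ} (x : Fin n → M.carrier) (j : Fin n) :
    (v.setNums x).num j = x j := by simp [setNums]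

lemma setNums_num_of_lt (v : Assignment M) {n : ℕ} (x : Fin n → M.carrier) {j : ℕ} (h : j < n) :
    (v.setNums x).num j = x ⟨j, h⟩ := by simp [setNums, h]

lemma setNums_num_of_le (v : Assignment M) {n : ℕ} (x : Fin n → M.carrier) {j : ℕ} (h : n ≤ j) :
    (v.setNums x).num j = v.num j := by simp [setNums, Nat.not_lt.2 h]

lemma setNums_setNum (v : Assignment M) {n : ℕ} (x : Fin n → M.carrier) (a : M.carrier) :
    (v.setNums x).setNum n a = v.setNums (Fin.snoc x a : Fin (n + 1) → M.carrier) := by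
  simp only [setNums, setNum, mk.injEq, and_true]
  funext i
  rcases lt_trichotomy i n with h | rfl | h
  · rw [Function.update_of_ne h.ne]
    simp [h, Nat.lt_succ_of_lt h, Fin.snoc]
  · simp [Fin.snoc]
  · rw [Function.update_of_ne h.ne']
    simp [Nat.not_lt.2 h.le, Nat.not_lt.2 (Nat.succ_le_of_lt h)]

end Assignment

open Assignment

variable {M : Model}

lemma holds_allNums (n : ℕ) (φ : Formula) (v : Assignment M) :
    (Formula.allNums n φ).Holds v ↔ ∀ x : Fin n → M.carrier, φ.Holds (v.setNums x) := by
  induction n generalizing φ with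
  | zero =>
    have h : ∀ x : Fin 0 → M.carrier, v.setNums x = v := fun x => by simp [setNums]
    simp [Formula.allNums, h]
  | succ n ih =>
    have h : Formula.allNums (n + 1) φ = Formula.allNums n (.allNum n φ) := by
      simp [Formula.allNums, List.range_succ]
    rw [h, ih]
    simp only [Formula.Holds, setNums_setNum]
    constructor
    · intro H x
      have := H (Fin.init x) (x (Fin.last n))
      rwa [Fin.snoc_init_self] at this
    · exact fun H x a => H _

lemma Term.eval_subst (v : Assignment M) (t : Term) (i : ℕ) (u : Term) :
    (t.subst i u).eval v = t.eval (v.setNum i (u.eval v)) := by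
  induction t with
  | var j =>
    by_cases h : j = i
    · subst h; simp [Term.subst, Term.eval]
    · simp [Term.subst, Term.eval, h, setNum_num]
  | sym p t ih => simp [Term.subst, Term.eval, ih]
  | app n f t ih => simp [Term.subst, Term.eval, ih]

lemma QF.holds_subst (v : Assignment M) (θ : QF) (i : ℕ) (u : Term) :
    (θ.subst i u).Holds v ↔ θ.Holds (v.setNum i (u.eval v)) := by
  induction θ <;> simp_all [QF.subst, QF.Holds, Term.eval_subst]

lemma Term.eval_setFun (v : Assignment M) (t : Term) {n f : ℕ} (F : M.Fun n)
    (h : t.FreshFun n f) : t.eval (v.setFun n f F) = t.eval v := by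
  induction t with
  | var j => rfl
  | sym p t ih =>
    simp only [Term.eval]
    congr 1
    exact funext fun j => ih j (h j)
  | app m g t ih =>
    have h1 : (v.setFun n f F).func m g = v.func m g := by
      by_cases hm : m = n
      · subst hm
        exact setFun_func_of_ne _ (fun hg => h.1 ⟨rfl, hg⟩) _
      · rw [setFun_func_of_arity_ne _ hm]
    simp only [Term.eval, h1, fun j => ih j (h.2 j)]

lemma QF.holds_setFun (v : Assignment M) (θ : QF) {n f : ℕ} (F : M.Fun n)
    (h : θ.FreshFun n f) : θ.Holds (v.setFun n f F) ↔ θ.Holds v := by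
  induction θ with
  | eq t u => simp [QF.Holds, Term.eval_setFun v _ F h.1, Term.eval_setFun v _ F h.2]
  | lt t u => simp [QF.Holds, Term.eval_setFun v _ F h.1, Term.eval_setFun v _ F h.2]
  | neg θ ih => simp [QF.Holds, ih h]
  | and θ η ih ih' => simp [QF.Holds, ih h.1, ih' h.2]
  | or θ η ih ih' => simp [QF.Holds, ih h.1, ih' h.2]
  | imp θ η ih ih' => simp [QF.Holds, ih h.1, ih' h.2]

lemma QF.holds_conj (v : Assignment M) (l : List QF) :
    (QF.conj l).Holds v ↔ ∀ θ ∈ l, θ.Holds v := by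
  induction l <;> simp_all [QF.conj, QF.Holds]

/-! ### The axioms and principles read inside a model -/

namespace Model

/-- The interpretation of `0`. -/
def zero (M : Model) : M.carrier := M.sym PRSymbol.zero Fin.elim0

/-- The interpretation of the successor. -/
def succ (M : Model) (a : M.carrier) : M.carrier := M.sym PRSymbol.succ fun _ => a

/-- The interpretation of the numerals. -/
def numeral (M : Model) : ℕ → M.carrier
  | 0 => M.zero
  | k + 1 => M.succ (M.numeral k)

/-- The tuple is increasing. -/
def Increasing (M : Model) {n : ℕ} (x : Fin n → M.carrier) : Prop :=
  ∀ i j : Fin n, (j : ℕ) = i + 1 → M.lt (x i) (x j)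

/-- Ramsey's theorem for `n`-element sets and colours less than `κ`, read in the model. -/
def Ramsey (M : Model) (n : ℕ) (κ : M.carrier) : Prop :=
  ∀ F ∈ M.Fun n, (∀ x, M.Increasing x → M.lt (F x) κ) →
    ∃ H ∈ M.Fun 1, (∀ a, H (fun _ => a) = M.zero ∨ H (fun _ => a) = M.numeral 1) ∧
      (∀ a, ∃ b, M.lt a b ∧ H (fun _ => b) = M.numeral 1) ∧
      ∃ c, ∀ x, M.Increasing x → (∀ j, H (fun _ => x j) = M.numeral 1) → F x = c

end Model

@[simp] lemma Term.eval_zero (v : Assignment M) : Term.zero.eval v = M.zero := by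
  simp only [Term.zero, Term.eval, Model.zero]
  congr 1
  exact funext fun i => i.elim0

@[simp] lemma Term.eval_succ (v : Assignment M) (t : Term) :
    t.succ.eval v = M.succ (t.eval v) := rfl

@[simp] lemma Term.eval_numeral (v : Assignment M) (k : ℕ) :
    (Term.numeral k).eval v = M.numeral k := by
  induction k with
  | zero => simp [Term.numeral, Model.numeral]
  | succ k ih => simp [Term.numeral, Model.numeral, ih]

lemma holds_increasing (v : Assignment M) {n : ℕ} (x : Fin n → M.carrier) :
    (increasing n).Holds (v.setNums x) ↔ M.Increasing x := by
  simp only [increasing, QF.holds_conj, List.mem_map, List.mem_range, forall_exists_index, and_imp,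
    forall_apply_eq_imp_iff₂, QF.Holds, Term.eval, Model.Increasing]
  constructor
  · rintro h ⟨i, hi⟩ ⟨j, hj⟩ hij
    simp only at hij
    subst hij
    have := h i (by omega)
    rwa [setNums_num_of_lt _ _ hi, setNums_num_of_lt _ _ hj] at this
  · intro h i hi
    rw [setNums_num_of_lt _ _ (by omega : i < n), setNums_num_of_lt _ _ (by omega : i + 1 < n)]
    exact h _ _ rfl

/-- The hypothesis `hk` expresses that the bound on the colours does not depend on the colouring or
on `x₀, ..., xₙ₋₁`. The variable `xₙ` for the homogeneous colour lies just outside the quantified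
block, and for `n = 1` the colouring and the set share an arity but not a name. -/
lemma holds_ramseyFor (v : Assignment M) {n : ℕ} (k : Term) (κ : M.carrier)
    (hk : ∀ (F : M.Fun n) (x : Fin n → M.carrier),
      k.eval ((v.setFun n 0 F).setNums x) = κ) :
    (ramseyFor n k).Holds v ↔ M.Ramsey n κ := by
  have hmem : ∀ (F : M.Fun n) (H : M.Fun 1), ((v.setFun n 0 F).setFun 1 1 H).func n 0 = F := by
    intro F H
    by_cases h : n = 1
    · subst h; rw [setFun_func_of_ne _ (by norm_num)]; simp
    · rw [setFun_func_of_arity_ne _ h]; simp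
  have hv : ∀ (w : Assignment M) (x : Fin n → M.carrier),
      (fun j => Term.eval (w.setNums x) (Term.vars n j)) = x := fun w x => by
    funext j; simp [Term.vars, Term.eval]
  have hset : ∀ (w : Assignment M) (c : M.carrier) (x : Fin n → M.carrier),
      ((w.setNum n c).setNums x).num n = c := fun w c x => by
    rw [setNums_num_of_le _ _ le_rfl]; simp
  have hset0 : ∀ (w : Assignment M) (a b : M.carrier),
      ((w.setNum 0 a).setNum 1 b).num 0 = a := fun w a b => by
    rw [setNum_num_of_ne _ (by norm_num)]; simp
  have hH : ∀ (H : M.Fun 1) (t : Term) (w' : Assignment M), w'.func 1 1 = H →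
      ((mem t).Holds w' ↔ H.1 (fun _ => t.eval w') = M.numeral 1) := fun H t w' hw => by
    simp [mem, QF.Holds, Term.eval, hw]
  have hj : ∀ (H : M.Fun 1) (w' : Assignment M) (x : Fin n → M.carrier), w'.func 1 1 = H →
      ((QF.conj ((List.range n).map (fun j => mem (.var j)))).Holds (w'.setNums x) ↔
        ∀ j, H.1 (fun _ => x j) = M.numeral 1) := fun H w' x hw => by
    rw [QF.holds_conj]
    simp only [List.mem_map, List.mem_range, forall_exists_index, and_imp,
      forall_apply_eq_imp_iff₂]
    constructor
    · intro h j
      have := h j j.2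
      rw [hH H _ _ (by simpa using hw)] at this
      simpa [Term.eval] using this
    · intro h j hj
      rw [hH H _ _ (by simpa using hw)]
      have := h ⟨j, hj⟩
      simpa [Term.eval, setNums_num_of_lt _ _ hj] using this
  simp only [ramseyFor, Formula.Holds, holds_allNums, QF.Holds, holds_increasing,
    Model.Ramsey]
  constructor
  · intro h F hF hc
    obtain ⟨H, h1, h2, c, h3⟩ := h ⟨F, hF⟩ (fun x hx => by
      rw [hk]; simpa [Term.eval, hv, hx] using hc x hx)
    refine ⟨H.1, H.2, fun a => ?_, fun a => ?_, c, fun x hx hxH => ?_⟩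
    · simpa [Term.eval, Model.numeral] using h1 a
    · obtain ⟨b, hb, hb'⟩ := h2 a
      rw [hH H _ _ (by simp)] at hb'
      simp only [Term.eval, hset0, setNum_num_self] at hb hb'
      exact ⟨b, hb, hb'⟩
    · have := h3 x ⟨hx, (hj H _ x (by simp)).2 hxH⟩
      simp only [Term.eval, setNums_func, setNum_func, hmem, hv, hset] at this
      exact this
  · intro h F hc
    obtain ⟨H, hH', h1, h2, c, h3⟩ := h F.1 F.2 (fun x hx => by
      have := hc x hx
      rw [hk] at this
      simpa [Term.eval, hv, hx] using this)
    refine ⟨⟨H, hH'⟩, fun a => ?_, fun a => ?_, c, fun x hx => ?_⟩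
    · simpa [Term.eval, Model.numeral] using h1 a
    · obtain ⟨b, hb, hb'⟩ := h2 a
      refine ⟨b, ?_, ?_⟩
      · simp only [Term.eval, hset0, setNum_num_self]; exact hb
      · rw [hH ⟨H, hH'⟩ _ _ (by simp)]
        simp only [Term.eval, setNum_num_self]
        exact hb'
    · have := h3 x hx.1 ((hj ⟨H, hH'⟩ _ x (by simp)).1 hx.2)
      simp only [Term.eval, setNums_func, setNum_func, hmem, hv, hset]
      exact this

instance (M : Model) : Nonempty (Assignment M) :=
  ⟨⟨fun _ => M.zero, fun n _ => ⟨_, (M.fun_nonempty n).some_mem⟩⟩⟩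

lemma satisfies_RT_iff (n k : ℕ) :
    M.Satisfies (RT n k) ↔ M.Ramsey n (M.numeral k) := by
  have h : ∀ v : Assignment M, (ramseyFor n (.numeral k)).Holds v ↔ M.Ramsey n (M.numeral k) :=
    fun v => holds_ramseyFor v _ _ fun F x => by simp
  simp [Model.Satisfies, RT, h]

lemma satisfies_RT1Fin_iff :
    M.Satisfies RT1Fin ↔ ∀ a, M.Ramsey 1 a := by
  have h : ∀ (v : Assignment M) (a : M.carrier),
      (ramseyFor 1 (.var 2)).Holds (v.setNum 2 a) ↔ M.Ramsey 1 a :=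
    fun v a => holds_ramseyFor _ _ _ fun F x => by
      simp [Term.eval, setNums_num_of_le _ x (by norm_num : 1 ≤ 2)]
  simp [Model.Satisfies, RT1Fin, Formula.Holds, h]

/-- A model satisfies `PRA²` as soon as it satisfies the axioms read semantically. -/
theorem satisfies_PRA2 (M : Model)
    (zero_ne_succ : ∀ a, M.zero ≠ M.succ a)
    (succ_inj : ∀ a b, M.succ a = M.succ b → a = b)
    (not_lt_zero : ∀ a, ¬ M.lt a M.zero)
    (lt_succ : ∀ a b, M.lt a (M.succ b) ↔ M.lt a b ∨ a = b)
    (sym_proj : ∀ {n : ℕ} (i : Fin n) (x : Fin n → M.carrier), M.sym (.proj i) x = x i)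
    (sym_comp : ∀ {m n : ℕ} (f : PRSymbol m) (g : Fin m → PRSymbol n) (x : Fin n → M.carrier),
      M.sym (.comp f g) x = M.sym f fun j => M.sym (g j) x)
    (sym_prec_zero : ∀ {n : ℕ} (f : PRSymbol n) (g : PRSymbol (n + 2)) (x : Fin n → M.carrier),
      M.sym (.prec f g) (Fin.cons M.zero x : Fin (n + 1) → M.carrier) = M.sym f x)
    (sym_prec_succ : ∀ {n : ℕ} (f : PRSymbol n) (g : PRSymbol (n + 2)) (a : M.carrier)
      (x : Fin n → M.carrier),
      M.sym (.prec f g) (Fin.cons (M.succ a) x : Fin (n + 1) → M.carrier) =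
        M.sym g (Fin.cons a (Fin.cons (M.sym (.prec f g) (Fin.cons a x : Fin (n + 1) → M.carrier))
          x : Fin (n + 1) → M.carrier) : Fin (n + 2) → M.carrier))
    (induction : ∀ (θ : QF) (i : ℕ) (v : Assignment M), θ.Holds (v.setNum i M.zero) →
      (∀ a, θ.Holds (v.setNum i a) → θ.Holds (v.setNum i (M.succ a))) →
      ∀ a, θ.Holds (v.setNum i a))
    (fun_sym : ∀ {n : ℕ} (p : PRSymbol n), M.sym p ∈ M.Fun n)
    (fun_const : ∀ (n : ℕ) (a : M.carrier), (fun _ => a) ∈ M.Fun n)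
    (fun_comp : ∀ {m n : ℕ}, ∀ f ∈ M.Fun m, ∀ g : Fin m → M.Fun n,
      (fun x => f fun j => (g j).1 x) ∈ M.Fun n)
    (fun_prec : ∀ {n : ℕ}, ∀ f ∈ M.Fun n, ∀ g ∈ M.Fun (n + 2), ∃ h ∈ M.Fun (n + 1),
      (∀ x : Fin n → M.carrier, h (Fin.cons M.zero x : Fin (n + 1) → M.carrier) = f x) ∧
      ∀ (a : M.carrier) (x : Fin n → M.carrier),
        h (Fin.cons (M.succ a) x : Fin (n + 1) → M.carrier) =
        g (Fin.cons a (Fin.cons (h (Fin.cons a x : Fin (n + 1) → M.carrier))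
          x : Fin (n + 1) → M.carrier) : Fin (n + 2) → M.carrier)) :
    M.Satisfies PRA2 := by
  have hv : ∀ {n : ℕ} (w : Assignment M),
      (fun j => Term.eval w (Term.vars n j)) = fun j : Fin n => w.num j := fun w => rfl
  have hv' : ∀ {n : ℕ} (w : Assignment M) (x : Fin n → M.carrier),
      (fun j => Term.eval (w.setNums x) (Term.vars n j)) = x := fun w x => by
    funext j; simp [Term.vars, Term.eval]
  have hcons : ∀ {n : ℕ} (w : Assignment M) (t : Term) (s : Fin n → Term),
      (fun j => Term.eval w ((Fin.cons t s : Fin (n + 1) → Term) j)) =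
        (Fin.cons (t.eval w) fun j => (s j).eval w : Fin (n + 1) → M.carrier) := fun w t s => by
    funext j
    refine Fin.cases ?_ (fun j => ?_) j <;> simp
  rintro φ hφ v
  cases (hφ : PRA2Axiom φ) with
  | zero_ne_succ => simpa [Formula.Holds, QF.Holds] using zero_ne_succ _
  | succ_inj => simpa [Formula.Holds, QF.Holds] using succ_inj _ _
  | not_lt_zero => simpa [Formula.Holds, QF.Holds] using not_lt_zero _
  | lt_succ =>
    simp only [Formula.Holds, QF.Holds, Term.eval_succ]
    exact ⟨(lt_succ _ _).1, (lt_succ _ _).2⟩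
  | proj_def i => simp [Formula.Holds, QF.Holds, Term.eval, hv, sym_proj]
  | comp_def f g => simp [Formula.Holds, QF.Holds, Term.eval, hv, sym_comp]
  | prec_zero_def f g => simp [Formula.Holds, QF.Holds, Term.eval, hv, hcons, sym_prec_zero]
  | prec_succ_def f g => simp [Formula.Holds, QF.Holds, Term.eval, hv, hcons, sym_prec_succ]
  | induction θ i =>
    simp only [Formula.Holds, QF.Holds, QF.holds_subst, Term.eval_zero, Term.eval_succ, Term.eval,
      setNum_num_self, setNum_setNum]
    exact fun h => induction θ i v h.1 h.2
  | fun_sym p =>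
    refine ⟨⟨_, fun_sym p⟩, ?_⟩
    rw [holds_allNums]
    intro x
    simp [Formula.Holds, QF.Holds, Term.eval, hv']
  | fun_const n =>
    refine ⟨⟨_, fun_const n (v.num n)⟩, ?_⟩
    rw [holds_allNums]
    intro x
    simp [Formula.Holds, QF.Holds, Term.eval, setNums_num_of_le]
  | fun_comp m n =>
    refine ⟨⟨_, fun_comp _ (v.func m 0).2 fun j => v.func n (j + 1)⟩, ?_⟩
    rw [holds_allNums]
    intro x
    have h1 : ∀ F, (v.setFun n (m + 1) F).func m 0 = v.func m 0 := fun F => by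
      by_cases h : m = n
      · subst h; exact setFun_func_of_ne _ (by omega) _
      · rw [setFun_func_of_arity_ne _ h]
    have h2 : ∀ F (j : Fin m), (v.setFun n (m + 1) F).func n (j + 1) = v.func n (j + 1) :=
      fun F j => setFun_func_of_ne _ (by omega) _
    simp [Formula.Holds, QF.Holds, Term.eval, hv', h1, h2]
  | fun_prec n =>
    obtain ⟨h, hh, h0, hs⟩ := fun_prec _ (v.func n 0).2 _ (v.func (n + 2) 1).2
    refine ⟨⟨h, hh⟩, ?_⟩
    have h1 : ∀ F, (v.setFun (n + 1) 2 F).func n 0 = v.func n 0 := fun F => by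
      rw [setFun_func_of_arity_ne _ (by omega)]
    have h2 : ∀ F, (v.setFun (n + 1) 2 F).func (n + 2) 1 = v.func (n + 2) 1 := fun F => by
      rw [setFun_func_of_arity_ne _ (by omega)]
    have hx : ∀ (w : Assignment M) (x : Fin (n + 1) → M.carrier),
        (fun j => Term.eval (w.setNums x) (Term.vars n j)) = Fin.init x := fun w x => by
      funext j
      simp only [Term.vars, Term.eval, Fin.init]
      exact setNums_num_fin w x j.castSucc
    have hl : ∀ (w : Assignment M) (x : Fin (n + 1) → M.carrier),
        (w.setNums x).num n = x (Fin.last n) := fun w x => setNums_num_fin w x (Fin.last n)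
    simp only [Formula.Holds, holds_allNums]
    constructor
    · intro x
      simp [QF.Holds, Term.eval, hcons, hv', h1, h0]
    · intro x
      simp [QF.Holds, Term.eval, hcons, hx, hl, h2, hs]

lemma satisfies_QFAC_iff : M.Satisfies QFAC ↔ ∀ (θ : QF) (i j f : ℕ), i ≠ j → θ.FreshFun 1 f →
    ∀ v : Assignment M, (∀ a, ∃ b, θ.Holds ((v.setNum i a).setNum j b)) →
      ∃ F : M.Fun 1, ∀ a, θ.Holds ((v.setNum i a).setNum j (F.1 fun _ => a)) := by
  have key : ∀ (θ : QF) (i j f : ℕ), θ.FreshFun 1 f → ∀ (v : Assignment M) (F : M.Fun 1) a,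
      (θ.subst j (.app 1 f (fun _ => .var i))).Holds ((v.setFun 1 f F).setNum i a) ↔
        θ.Holds ((v.setNum i a).setNum j (F.1 fun _ => a)) := by
    intro θ i j f hf v F a
    rw [QF.holds_subst]
    simp only [Term.eval, setNum_num_self, setNum_func, setFun_func_self]
    rw [setNum_setFun, setNum_setFun, QF.holds_setFun _ _ _ hf]
  constructor
  · intro h θ i j f hij hf v hv
    obtain ⟨F, hF⟩ := h _ ⟨θ, i, j, f, hij, hf, rfl⟩ v hv
    exact ⟨F, fun a => (key θ i j f hf v F a).1 (hF a)⟩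
  · rintro h φ ⟨θ, i, j, f, hij, hf, rfl⟩ v hv
    obtain ⟨F, hF⟩ := h θ i j f hij hf v hv
    exact ⟨F, fun a => (key θ i j f hf v F a).2 (hF a)⟩

end SecondOrderPRA

namespace SecondOrderPRA

namespace PRSymbol

/-- The primitive recursive function defined by a symbol. -/
def eval : ∀ {n : ℕ}, PRSymbol n → (Fin n → ℕ) → ℕ
  | _, zero, _ => 0
  | _, succ, x => x 0 + 1
  | _, proj i, x => x i
  | _, comp f g, x => f.eval fun j => (g j).eval x
  | _, prec f g, x => Nat.rec (f.eval (Fin.tail x))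
      (fun t r => g.eval (Fin.cons t (Fin.cons r (Fin.tail x)))) (x 0)

end PRSymbol

/-! ### The infinite Ramsey theorem by ultrafilter limits -/

section InfiniteRamsey

open Filter

/-- The limit along a non-principal ultrafilter of a function with finitely many values. -/
noncomputable def ultraLim (g : ℕ → ℕ) : ℕ :=
  Classical.epsilon fun d => ∀ᶠ y in (hyperfilter ℕ : Filter ℕ), g y = d

/-- An ultrafilter containing a finite union contains one of its members, so the limit is a genuine
one and not the junk value of `epsilon`. -/
lemma eventually_eq_ultraLim {g : ℕ → ℕ} {k : ℕ} (hg : ∀ y, g y < k) :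
    ∀ᶠ y in (hyperfilter ℕ : Filter ℕ), g y = ultraLim g := by
  refine Classical.epsilon_spec (p := fun d => ∀ᶠ y in (hyperfilter ℕ : Filter ℕ), g y = d) ?_
  have h : ∀ᶠ y in (hyperfilter ℕ : Filter ℕ), ∃ d ∈ Set.Iio k, g y = d :=
    Eventually.of_forall fun y => ⟨g y, hg y, rfl⟩
  obtain ⟨d, -, hd⟩ := (Ultrafilter.eventually_exists_mem_iff (Set.finite_Iio k)).1 h
  exact ⟨d, hd⟩

/-- The `r`-fold iterated limit colour of a colouring of finite sets. -/
noncomputable def limColour (f : Finset ℕ → ℕ) : ℕ → Finset ℕ → ℕ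
  | 0, s => f s
  | r + 1, s => ultraLim fun y => limColour f r (insert y s)

lemma limColour_lt {f : Finset ℕ → ℕ} {k : ℕ} (hf : ∀ s, f s < k) (r : ℕ) (s : Finset ℕ) :
    limColour f r s < k := by
  induction r generalizing s with
  | zero => exact hf s
  | succ r ih =>
    obtain ⟨y, hy⟩ := (eventually_eq_ultraLim fun y => ih (insert y s)).exists
    exact (show limColour f (r + 1) s = _ from hy.symm) ▸ ih (insert y s)

/-- The infinite Ramsey theorem for colourings of finite sets. -/
theorem exists_infinite_homogeneous (n : ℕ) {k : ℕ} (f : Finset ℕ → ℕ) (hf : ∀ s, f s < k) :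
    ∃ H : Set ℕ, H.Infinite ∧ ∃ c, ∀ s : Finset ℕ, s.card = n → ↑s ⊆ H → f s = c := by
  classical
  set c := limColour f n ∅
  let Good : Finset ℕ → Prop := fun S => ∀ s ⊆ S, ∀ r, s.card + r = n → limColour f r s = c
  -- Almost every `y` extends a good set: adjoining `y` to `s` realizes one of the iterated limits,
  -- and only finitely many conditions on `y` arise. In the limit the 0-fold limit colour, that is
  -- the colour itself, is `c` on all `n`-element subsets.
  have step : ∀ S : {S // Good S}, ∃ S' : {S // Good S}, S < S' := by
    rintro ⟨S, hS⟩
    have h1 : ∀ᶠ y in (hyperfilter ℕ : Filter ℕ), ∀ s ∈ S.powerset, ∀ r ∈ Finset.range n,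
        limColour f r (insert y s) = limColour f (r + 1) s := by
      simp only [Filter.eventually_all_finset]
      exact fun s _ r _ => eventually_eq_ultraLim fun y => limColour_lt hf r _
    have h2 : ∀ᶠ y in (hyperfilter ℕ : Filter ℕ), y ∉ S :=
      hyperfilter_le_cofinite S.finite_toSet.eventually_cofinite_notMem
    obtain ⟨y, hy, hyS⟩ := (h1.and h2).exists
    refine ⟨⟨insert y S, fun s hs r hr => ?_⟩, Finset.ssubset_insert hyS⟩
    by_cases hys : y ∈ s
    · have he : s.erase y ⊆ S := by rwa [← Finset.subset_insert_iff]
      have hc := Finset.card_erase_add_one hys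
      have := hy (s.erase y) (Finset.mem_powerset.2 he) r (Finset.mem_range.2 (by omega))
      rw [Finset.insert_erase hys] at this
      rw [this]
      exact hS _ he _ (by omega)
    · exact hS s ((Finset.subset_insert_iff_of_notMem hys).1 hs) r hr
  choose g hg using step
  have h0 : Good ∅ := fun s hs r hr => by
    obtain rfl := Finset.subset_empty.1 hs
    simp only [Finset.card_empty, zero_add] at hr
    rw [hr]
  let S : ℕ → {S // Good S} := fun i => g^[i] ⟨∅, h0⟩
  have hS : StrictMono S := strictMono_nat_of_lt_succ fun i => by
    simp only [S, Function.iterate_succ_apply']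
    exact hg _
  have hcard : ∀ i, i ≤ (S i).1.card := fun i => by
    induction i with
    | zero => simp
    | succ i ih => exact ih.trans_lt (Finset.card_lt_card (hS (Nat.lt_succ_self i)))
  refine ⟨⋃ i, ((S i).1 : Set ℕ), fun hfin => ?_, c, fun s hs hsH => ?_⟩
  · have := Finset.card_le_card (s := (S (hfin.toFinset.card + 1)).1) (t := hfin.toFinset)
      fun x hx => by simpa using ⟨_, hx⟩
    have := hcard (hfin.toFinset.card + 1)
    omega
  · have hmono : Monotone fun i => ((S i).1 : Set ℕ) := fun i j hij =>
      Finset.coe_subset.2 (hS.monotone hij)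
    obtain ⟨i, hi⟩ := hmono.directed_le.exists_mem_subset_of_finset_subset_biUnion hsH
    exact (S i).2 s (Finset.coe_subset.1 hi) 0 (by omega)

/-- The infinite Ramsey theorem for colourings of increasing tuples. -/
theorem exists_infinite_homogeneous_tuple {n k : ℕ} (f : (Fin n → ℕ) → ℕ)
    (hf : ∀ x, StrictMono x → f x < k) :
    ∃ H : Set ℕ, H.Infinite ∧ ∃ c, ∀ x : Fin n → ℕ, StrictMono x → (∀ j, x j ∈ H) → f x = c := by
  classical
  -- Sets of the wrong size receive the junk colour 0, which must be below `k`.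
  have hk : 0 < k := (Nat.zero_le _).trans_lt (hf (fun j => j) fun i j h => h)
  obtain ⟨H, hH, c, hc⟩ := exists_infinite_homogeneous n (k := k)
    (fun s => if h : s.card = n then f (s.orderEmbOfFin h) else 0) (fun s => by
      split_ifs with h
      · exact hf _ (s.orderEmbOfFin h).strictMono
      · exact hk)
  refine ⟨H, hH, c, fun x hx hxH => ?_⟩
  have hcard : (Finset.univ.image x).card = n := by
    rw [Finset.card_image_of_injective _ hx.injective, Finset.card_univ, Fintype.card_fin]
  have := hc (Finset.univ.image x) hcard (by simpa [Set.range_subset_iff] using hxH)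
  rw [dif_pos hcard] at this
  rwa [← Finset.orderEmbOfFin_unique hcard (fun j => by simp) hx] at this

end InfiniteRamsey

/-! ### The standard model of functions majorized by primitive recursive ones -/

/-- A function is majorized by a primitive recursive function of the maximum of its arguments. -/
def PrimrecMajorized {n : ℕ} (f : (Fin n → ℕ) → ℕ) : Prop :=
  ∃ G : ℕ → ℕ, Primrec G ∧ Monotone G ∧ ∀ (b : ℕ) (x : Fin n → ℕ), (∀ i, x i ≤ b) → f x ≤ G b

namespace PrimrecMajorized

lemma of_le_const {n : ℕ} {f : (Fin n → ℕ) → ℕ} (a : ℕ) (h : ∀ x, f x ≤ a) :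
    PrimrecMajorized f :=
  ⟨fun _ => a, Primrec.const a, monotone_const, fun _ x _ => h x⟩

lemma proj {n : ℕ} (i : Fin n) : PrimrecMajorized fun x => x i :=
  ⟨id, Primrec.id, monotone_id, fun _ _ h => h i⟩

lemma succ : PrimrecMajorized fun x : Fin 1 → ℕ => x 0 + 1 :=
  ⟨Nat.succ, Primrec.succ, fun _ _ h => Nat.succ_le_succ h, fun _ _ h => Nat.succ_le_succ (h 0)⟩

lemma exists_common {m n : ℕ} (g : Fin m → (Fin n → ℕ) → ℕ) (h : ∀ j, PrimrecMajorized (g j)) :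
    ∃ G : ℕ → ℕ, Primrec G ∧ Monotone G ∧
      ∀ (b : ℕ) (x : Fin n → ℕ), (∀ i, x i ≤ b) → ∀ j, g j x ≤ G b := by
  induction m with
  | zero => exact ⟨id, Primrec.id, monotone_id, fun _ _ _ j => j.elim0⟩
  | succ m ih =>
    obtain ⟨G, hG, hm, hle⟩ := ih (fun j => g j.succ) fun j => h j.succ
    obtain ⟨G', hG', hm', hle'⟩ := h 0
    refine ⟨fun b => G b + G' b, Primrec.nat_add.comp hG hG', hm.add hm', fun b x hx j => ?_⟩
    refine Fin.cases ?_ (fun j => ?_) j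
    · exact (hle' b x hx).trans (Nat.le_add_left _ _)
    · exact (hle b x hx j).trans (Nat.le_add_right _ _)

lemma comp {m n : ℕ} {f : (Fin m → ℕ) → ℕ} (hf : PrimrecMajorized f)
    {g : Fin m → (Fin n → ℕ) → ℕ} (hg : ∀ j, PrimrecMajorized (g j)) :
    PrimrecMajorized fun x => f fun j => g j x := by
  obtain ⟨F, hF, hFm, hFle⟩ := hf
  obtain ⟨G, hG, hGm, hGle⟩ := exists_common g hg
  exact ⟨fun b => F (G b), hF.comp hG, hFm.comp hGm, fun b x hx => hFle _ _ (hGle b x hx)⟩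

/-- Let `K` dominate both majorants and the identity. By induction the value after `t` steps is at
most `K^[t + 1] b`, because each step applies `g` to arguments that are already below the previous
iterate. At most `b` steps are needed. -/
lemma prec {n : ℕ} {f : (Fin n → ℕ) → ℕ} (hf : PrimrecMajorized f)
    {g : (Fin (n + 2) → ℕ) → ℕ} (hg : PrimrecMajorized g) :
    PrimrecMajorized fun x : Fin (n + 1) → ℕ => (Nat.rec (f (Fin.tail x))
      (fun t r => g (Fin.cons t (Fin.cons r (Fin.tail x)))) (x 0) : ℕ) := by
  obtain ⟨F, hF, hFm, hFle⟩ := hf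
  obtain ⟨G, hG, hGm, hGle⟩ := hg
  set K : ℕ → ℕ := fun b => F b + G b + b
  have hK : Primrec K := Primrec.nat_add.comp (Primrec.nat_add.comp hF hG) Primrec.id
  have hKm : Monotone K := (hFm.add hGm).add monotone_id
  have hKid : ∀ b, b ≤ K b := fun b => Nat.le_add_left _ _
  refine ⟨fun b => K^[b + 1] b, Primrec.nat_iterate Primrec.succ Primrec.id
    (hK.comp Primrec.snd).to₂, ?_,
    fun b x hx => ?_⟩
  · intro a b hab
    exact (hKm.iterate _ hab).trans
      (Function.monotone_iterate_of_id_le hKid (Nat.succ_le_succ hab) b)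
  · have key : ∀ t ≤ b, (Nat.rec (f (Fin.tail x))
        (fun t r => g (Fin.cons t (Fin.cons r (Fin.tail x)))) t : ℕ) ≤ K^[t + 1] b := by
      intro t
      induction t with
      | zero =>
        intro _
        exact (hFle b _ fun i => hx i.succ).trans
          ((Nat.le_add_right _ _).trans (Nat.le_add_right _ _))
      | succ t ih =>
        intro ht
        have hb : b ≤ K^[t + 1] b := Function.id_le_iterate_of_id_le hKid (t + 1) b
        rw [Function.iterate_succ_apply']
        refine (hGle (K^[t + 1] b) _ fun i => ?_).trans
          ((Nat.le_add_left _ _).trans (Nat.le_add_right _ _))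
        refine Fin.cases ?_ (fun i => Fin.cases ?_ (fun i => ?_) i) i
        · exact ((Nat.le_succ t).trans ht).trans hb
        · exact ih (by omega)
        · exact (hx i.succ).trans hb
    exact (key _ (hx 0)).trans (Function.monotone_iterate_of_id_le hKid (Nat.succ_le_succ (hx 0)) b)

lemma symbol {n : ℕ} (p : PRSymbol n) : PrimrecMajorized p.eval := by
  induction p with
  | zero => exact of_le_const 0 fun _ => le_rfl
  | succ => exact succ
  | proj i => exact proj i
  | comp f g hf hg => exact hf.comp hg
  | prec f g hf hg => exact hf.prec hg

end PrimrecMajorized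

/-- The standard numbers with all functions that are majorized by primitive recursive ones. -/
def majorizedModel : Model where
  carrier := ℕ
  sym := PRSymbol.eval
  lt := (· < ·)
  Fun _ := {f | PrimrecMajorized f}
  fun_nonempty _ := ⟨_, PrimrecMajorized.of_le_const (f := fun _ => 0) 0 fun _ => le_rfl⟩

lemma majorizedModel_satisfies_PRA2 : majorizedModel.Satisfies PRA2 :=
  satisfies_PRA2 majorizedModel (fun a => (Nat.succ_ne_zero a).symm) (fun _ _ => Nat.succ.inj)
    Nat.not_lt_zero (fun _ _ => Nat.lt_succ_iff_lt_or_eq) (fun _ _ => rfl) (fun _ _ _ => rfl)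
    (fun _ _ _ => rfl) (fun _ _ _ _ => rfl)
    (fun θ i v h0 hs a => Nat.rec (motive := fun a => θ.Holds (v.setNum i a)) h0 hs a)
    PrimrecMajorized.symbol
    (fun _ a => PrimrecMajorized.of_le_const a fun _ => le_rfl)
    (fun _ hf g => PrimrecMajorized.comp hf fun j => (g j).2)
    (fun _ hf _ hg => ⟨_, PrimrecMajorized.prec hf hg, fun _ => rfl, fun _ _ => rfl⟩)

lemma majorizedModel_numeral (k : ℕ) : majorizedModel.numeral k = k := by
  induction k with
  | zero => rfl
  | succ k ih => simp only [Model.numeral, ih]; rfl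

/-- A characteristic function is bounded by 1, so any homogeneous set, however complicated, belongs
to the model. -/
lemma majorizedModel_ramsey (n k : ℕ) : majorizedModel.Ramsey n k := by
  classical
  intro F _ hc
  have hinc : ∀ x : Fin n → ℕ, majorizedModel.Increasing x ↔ StrictMono x := by
    intro x
    cases n with
    | zero => exact ⟨fun _ i => i.elim0, fun _ i => i.elim0⟩
    | succ n =>
      rw [Fin.strictMono_iff_lt_succ]
      refine ⟨fun h i => h _ _ (by simp), fun h i j hij => ?_⟩
      have hi : (i : ℕ) < n := by omega
      have h1 : i = Fin.castSucc ⟨i, hi⟩ := rfl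
      have h2 : j = Fin.succ ⟨i, hi⟩ := Fin.ext (by simp [hij])
      rw [h1, h2]
      exact h _
  obtain ⟨H, hH, c, hHc⟩ := exists_infinite_homogeneous_tuple (k := k) F
    fun x hx => hc x ((hinc x).2 hx)
  let χ : (Fin 1 → ℕ) → ℕ := fun x => if x 0 ∈ H then 1 else 0
  have hmem : ∀ a : ℕ, χ (fun _ => a) = majorizedModel.numeral 1 ↔ a ∈ H :=
    fun a => by rw [majorizedModel_numeral]; simp [χ]
  refine ⟨χ, PrimrecMajorized.of_le_const 1 fun x => ?_,
    fun a => ?_, fun a => ?_, c, fun x hx hxH => hHc x ((hinc x).1 hx) fun j => ?_⟩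
  · simp only [χ]; split_ifs <;> simp
  · by_cases h : a ∈ H
    · exact Or.inr ((hmem a).2 h)
    · exact Or.inl (if_neg h)
  · obtain ⟨b, hb, hab⟩ := hH.exists_gt a
    exact ⟨b, hab, (hmem b).2 hb⟩
  · exact (hmem _).1 (hxH j)

/-- The graph of `a ↦ ack a a` has a characteristic function in the model. A choice function for it
would make `ack a a` primitive recursively bounded. -/
lemma majorizedModel_not_satisfies_QFAC : ¬ majorizedModel.Satisfies QFAC := by
  classical
  intro h
  rw [satisfies_QFAC_iff] at h
  let χ : (Fin 2 → ℕ) → ℕ := fun x => if x 1 = ack (x 0) (x 0) then 1 else 0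
  let A : majorizedModel.Fun 2 := ⟨χ,
    PrimrecMajorized.of_le_const 1 fun x => by simp only [χ]; split_ifs <;> simp⟩
  obtain ⟨v⟩ : Nonempty (Assignment majorizedModel) := inferInstance
  have key : ∀ a b : ℕ, (QF.eq (.app 2 0 (Term.vars 2)) (Term.numeral 1)).Holds
      (((v.setFun 2 0 A).setNum 0 a).setNum 1 b) ↔ b = ack a a := by
    intro a b
    have h : ∀ x : Fin 2 → ℕ, x 0 = a → x 1 = b → (χ x = 1 ↔ b = ack a a) :=
      fun x h0 h1 => by simp [χ, h0, h1]
    have hA : (((v.setFun 2 0 A).setNum 0 a).setNum 1 b).func 2 0 = A :=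
      Assignment.setFun_func_self v 2 0 A
    simp only [QF.Holds, Term.eval, hA, Term.eval_numeral, majorizedModel_numeral]
    exact h (fun j => (((v.setFun 2 0 A).setNum 0 a).setNum 1 b).num j) rfl rfl
  obtain ⟨⟨F, G, hG, _, hle⟩, hF⟩ := h (.eq (.app 2 0 (Term.vars 2)) (Term.numeral 1)) 0 1 0
    (by norm_num) ⟨⟨by norm_num, fun _ => trivial⟩, by simp [Term.numeral, Term.succ, Term.zero,
      Term.FreshFun]⟩ (v.setFun 2 0 A) fun a => ⟨ack a a, (key a _).2 rfl⟩
  obtain ⟨m, hm⟩ := exists_lt_ack_of_nat_primrec (Primrec.nat_iff.1 hG)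
  have := (key m _).1 (hF m)
  exact absurd (hm m) (Nat.not_lt.2 (this ▸ hle m (fun _ => m) fun _ => le_rfl))

end SecondOrderPRA

namespace SecondOrderPRA

open Nat.Partrec (Code)
open Encodable Denumerable Filter

/-! ### Halting bounds and their approximations -/

section Stages

/-- Some program below `x` halts on some input below `x` at stage `t`, and not before. -/
def NewHalt (x t : ℕ) : Prop :=
  ∃ y < x, ∃ c < x, (Code.evaln t (ofNat Code c) y).isSome = true ∧
    ¬ (Code.evaln (t - 1) (ofNat Code c) y).isSome = true

open Classical in
/-- The last stage up to `s` at which a program below `x` halts on an input below `x`. -/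
noncomputable def haltTime (s x : ℕ) : ℕ := Nat.findGreatest (NewHalt x) s

/-- The last stage at which a program below `x` halts on an input below `x`. -/
noncomputable def haltLim (x : ℕ) : ℕ := sSup {t | NewHalt x t}

/-- The stage-`s` approximation to `stageLim j a`. -/
noncomputable def stage (s j a : ℕ) : ℕ := Nat.rec a (fun _ r => Nat.pair r (haltTime s r)) j

/-- The `j`-fold iteration of the halting bound, starting from `a`. -/
noncomputable def stageLim (j a : ℕ) : ℕ := Nat.rec a (fun _ r => Nat.pair r (haltLim r)) j

/-- The stage-`s` approximation to the `e`-th number that is generated from `a`. -/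
noncomputable def approx (s e a : ℕ) : ℕ :=
  (Code.evaln s (ofNat Code e.unpair.1) (stage s e.unpair.2 a)).getD 0

open Classical in
/-- A number up to `a` that is none of the first `a` numbers generated from `a`, as they appear at
stage `s`. -/
noncomputable def colour (a s : ℕ) : ℕ := Nat.findGreatest (fun b => ∀ e < a, approx s e a ≠ b) a

lemma colour_le (a s : ℕ) : colour a s ≤ a := Nat.findGreatest_le a

/-- Pigeonhole: at most `a` values are excluded from the `a + 1` candidates, so the search does not
return its default. -/
lemma approx_ne_colour {a e : ℕ} (s : ℕ) (he : e < a) : approx s e a ≠ colour a s := by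
  classical
  have h : ∃ b ≤ a, ∀ e < a, approx s e a ≠ b := by
    by_contra! hcon
    have hsub : Finset.range (a + 1) ⊆ (Finset.range a).image fun e => approx s e a := fun b hb => by
      obtain ⟨e, he, hb⟩ := hcon b (Nat.lt_succ_iff.1 (Finset.mem_range.1 hb))
      exact Finset.mem_image.2 ⟨e, Finset.mem_range.2 he, hb⟩
    have := (Finset.card_le_card hsub).trans Finset.card_image_le
    simp at this
  obtain ⟨b, hb, hb'⟩ := h
  exact Nat.findGreatest_spec (P := fun b => ∀ e < a, approx s e a ≠ b) hb hb' e he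

lemma isSome_evaln_mono {s t : ℕ} (h : s ≤ t) {c : Code} {y : ℕ}
    (hs : (Code.evaln s c y).isSome = true) : (Code.evaln t c y).isSome = true := by
  obtain ⟨z, hz⟩ := Option.isSome_iff_exists.1 hs
  exact Option.isSome_iff_exists.2 ⟨z, Code.evaln_mono h hz⟩

/-- Halting is monotone in the stage, so each of the finitely many pairs of a program and an input
has at most one first halting stage. -/
lemma bddAbove_newHalt (x : ℕ) : BddAbove {t | NewHalt x t} := by
  have h : {t | NewHalt x t} = ⋃ y ∈ Set.Iio x, ⋃ c ∈ Set.Iio x,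
      {t | (Code.evaln t (ofNat Code c) y).isSome = true ∧
        ¬ (Code.evaln (t - 1) (ofNat Code c) y).isSome = true} := by
    ext t
    simp only [NewHalt, Set.mem_ofPred_eq, Set.mem_iUnion, Set.mem_Iio, exists_prop]
  rw [h]
  refine ((Set.finite_Iio x).biUnion fun y _ => (Set.finite_Iio x).biUnion fun c _ =>
    Set.Subsingleton.finite ?_).bddAbove
  have key : ∀ {s t : ℕ}, (Code.evaln s (ofNat Code c) y).isSome = true →
      ¬ (Code.evaln (t - 1) (ofNat Code c) y).isSome = true → t ≤ s := fun {s t} hs ht => by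
    by_contra hlt
    exact ht (isSome_evaln_mono (by omega) hs)
  exact fun s hs t ht => le_antisymm (key ht.1 hs.2) (key hs.1 ht.2)

/-- If nothing ever halts, both sides are 0: the default of `Nat.findGreatest` and the supremum of
the empty set. -/
lemma haltTime_eq {s x : ℕ} (h : haltLim x ≤ s) : haltTime s x = haltLim x := by
  classical
  refine le_antisymm ?_ ?_
  · by_cases h0 : haltTime s x = 0
    · exact h0 ▸ Nat.zero_le _
    · exact le_csSup (bddAbove_newHalt x) (Nat.findGreatest_of_ne_zero rfl h0)
  · rcases Set.eq_empty_or_nonempty {t | NewHalt x t} with he | hne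
    · simp [haltLim, he]
    · exact Nat.le_findGreatest h (Nat.sSup_mem hne (bddAbove_newHalt x))

lemma evaln_haltLim {x y z t : ℕ} {c : Code} (hc : encode c < x) (hy : y < x)
    (h : z ∈ Code.evaln t c y) : z ∈ Code.evaln (haltLim x) c y := by
  classical
  have hex : ∃ t, (Code.evaln t c y).isSome = true := ⟨t, Option.isSome_iff_exists.2 ⟨z, h⟩⟩
  -- Nothing halts at stage 0, so the first halting stage has a true predecessor, as `NewHalt`
  -- requires.
  have hpos : Nat.find hex ≠ 0 := fun h0 => by
    have := Nat.find_spec hex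
    rw [h0] at this
    simp [Code.evaln] at this
  have hle : Nat.find hex ≤ haltLim x := le_csSup (bddAbove_newHalt x)
    ⟨y, hy, encode c, hc, by simpa using Nat.find_spec hex,
      by simpa using Nat.find_min hex (m := Nat.find hex - 1) (by omega)⟩
  obtain ⟨z', hz'⟩ := Option.isSome_iff_exists.1 (isSome_evaln_mono hle (Nat.find_spec hex))
  rwa [Part.mem_unique (Code.evaln_sound h) (Code.evaln_sound hz')]

lemma stageLim_succ (j a : ℕ) :
    stageLim (j + 1) a = Nat.pair (stageLim j a) (haltLim (stageLim j a)) := rfl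

lemma stageLim_mono (a : ℕ) : Monotone fun j => stageLim j a :=
  monotone_nat_of_le_succ fun _ => Nat.left_le_pair _ _

lemma le_stageLim (j a : ℕ) : a ≤ stageLim j a := stageLim_mono a (Nat.zero_le j)

lemma haltLim_stageLim_le (j a : ℕ) : haltLim (stageLim j a) ≤ stageLim (j + 1) a :=
  Nat.right_le_pair _ _

lemma lt_stageLim_succ {j a : ℕ} (h : 0 < stageLim j a) : stageLim j a < stageLim (j + 1) a := by
  rw [stageLim_succ, Nat.pair]
  split_ifs <;> nlinarith

lemma stage_eq {s j a : ℕ} (h : stageLim j a ≤ s) : stage s j a = stageLim j a := by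
  induction j with
  | zero => rfl
  | succ j ih =>
    have h1 := ih ((stageLim_mono a (Nat.le_succ j)).trans h)
    change Nat.pair (stage s j a) (haltTime s (stage s j a)) = _
    rw [h1, haltTime_eq ((haltLim_stageLim_le j a).trans h), stageLim_succ]

/-- Two iterations beyond `j` suffice: `stageLim (j + 1) a` exceeds both the program and its input
`stageLim j a`, so the computation halts by the bound included in `stageLim (j + 2) a`. -/
lemma approx_eq {c : Code} {j a z s : ℕ} (hc : encode c < a)
    (hz : z ∈ c.eval (stageLim j a)) (hs : stageLim (j + 2) a ≤ s) :
    approx s (Nat.pair (encode c) j) a = z := by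
  have h1 : stageLim j a < stageLim (j + 1) a := by
    have ha : 0 < stageLim j a := (Nat.zero_le _).trans_lt (hc.trans_le (le_stageLim j a))
    exact lt_stageLim_succ ha
  have h0 : stageLim j a ≤ s := (stageLim_mono a (by omega)).trans hs
  obtain ⟨t, ht⟩ := Code.evaln_complete.1 hz
  have h2 := evaln_haltLim (hc.trans_le (le_stageLim (j + 1) a)) h1 ht
  have h3 := Code.evaln_mono ((haltLim_stageLim_le (j + 1) a).trans hs) h2
  simp only [approx, Nat.unpair_pair, ofNat_encode, stage_eq h0]
  rw [Option.mem_def.1 h3]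
  rfl

end Stages

/-! ### Primitive recursiveness of the approximations and the colouring -/

section Primrec

lemma primrecRel_exists_lt {β : Type*} [Primcodable β] {R : ℕ → β → Prop} (h : PrimrecRel R) :
    PrimrecRel fun n b => ∃ x < n, R x b :=
  (h.exists_mem_list.comp (Primrec.list_range.comp Primrec.fst) Primrec.snd).of_eq (by simp)

lemma primrecRel_forall_lt {β : Type*} [Primcodable β] {R : ℕ → β → Prop} (h : PrimrecRel R) :
    PrimrecRel fun n b => ∀ x < n, R x b :=
  (h.forall_mem_list.comp (Primrec.list_range.comp Primrec.fst) Primrec.snd).of_eq (by simp)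

lemma primrec_haltTime : Primrec₂ haltTime := by
  classical
  have h1 : PrimrecRel fun (c : ℕ) (p : ℕ × ℕ × ℕ) =>
      (Code.evaln p.2.2 (ofNat Code c) p.1).isSome = true ∧
        ¬ (Code.evaln (p.2.2 - 1) (ofNat Code c) p.1).isSome = true := by
    have he : ∀ {f : ℕ × ℕ × ℕ × ℕ → ℕ}, Primrec f → PrimrecPred fun q : ℕ × ℕ × ℕ × ℕ =>
        (Code.evaln (f q) (ofNat Code q.1) q.2.1).isSome = true := fun hf =>
      Primrec.eq.comp (Primrec.option_isSome.comp (Code.primrec_evaln.comp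
        ((hf.pair ((Primrec.ofNat Code).comp Primrec.fst)).pair (Primrec.fst.comp Primrec.snd))))
        (Primrec.const true)
    have ht : Primrec fun q : ℕ × ℕ × ℕ × ℕ => q.2.2.2 :=
      Primrec.snd.comp (Primrec.snd.comp Primrec.snd)
    exact (he ht).and (he (Primrec.nat_sub.comp ht (Primrec.const 1))).not
  have h2 : PrimrecRel fun (y : ℕ) (p : ℕ × ℕ) => ∃ c < p.1,
      (Code.evaln p.2 (ofNat Code c) y).isSome = true ∧
        ¬ (Code.evaln (p.2 - 1) (ofNat Code c) y).isSome = true :=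
    (primrecRel_exists_lt h1).comp (f := fun q : ℕ × ℕ × ℕ => q.2.1) (g := fun q => q)
      (Primrec.fst.comp Primrec.snd) Primrec.id
  have h3 : PrimrecRel NewHalt :=
    (primrecRel_exists_lt h2).comp (f := fun q : ℕ × ℕ => q.1) (g := fun q => q)
      Primrec.fst Primrec.id
  exact Primrec.nat_findGreatest (f := fun p : ℕ × ℕ => p.1) (p := fun p t => NewHalt p.2 t)
    Primrec.fst (h3.comp (Primrec.snd.comp Primrec.fst) Primrec.snd)

lemma primrec_stage : Primrec fun p : ℕ × ℕ × ℕ => stage p.1 p.2.1 p.2.2 :=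
  Primrec.nat_rec' (h := fun p q => Nat.pair q.2 (haltTime p.1 q.2))
    (Primrec.fst.comp Primrec.snd) (Primrec.snd.comp Primrec.snd)
    (Primrec₂.natPair.comp (Primrec.snd.comp Primrec.snd)
      (primrec_haltTime.comp (Primrec.fst.comp Primrec.fst) (Primrec.snd.comp Primrec.snd)))

lemma primrec_approx : Primrec fun p : ℕ × ℕ × ℕ => approx p.1 p.2.1 p.2.2 := by
  have he : Primrec fun p : ℕ × ℕ × ℕ => p.2.1.unpair :=
    Primrec.unpair.comp (Primrec.fst.comp Primrec.snd)
  refine Primrec.option_getD.comp (Code.primrec_evaln.comp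
    ((Primrec.fst.pair ((Primrec.ofNat Code).comp (Primrec.fst.comp he))).pair ?_))
    (Primrec.const 0)
  exact primrec_stage.comp (Primrec.fst.pair
    ((Primrec.snd.comp he).pair (Primrec.snd.comp Primrec.snd)))

lemma primrec_colour : Primrec₂ colour := by
  classical
  have h1 : PrimrecRel fun (e : ℕ) (q : ℕ × ℕ × ℕ) => approx q.1 e q.2.1 ≠ q.2.2 :=
    (Primrec.eq.comp (primrec_approx.comp ((Primrec.fst.comp Primrec.snd).pair
      (Primrec.fst.pair (Primrec.fst.comp (Primrec.snd.comp Primrec.snd)))))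
      (Primrec.snd.comp (Primrec.snd.comp Primrec.snd))).not
  have h2 : PrimrecRel fun (p : ℕ × ℕ) (b : ℕ) => ∀ e < p.1, approx p.2 e p.1 ≠ b :=
    (primrecRel_forall_lt h1).comp (f := fun q : (ℕ × ℕ) × ℕ => q.1.1)
      (g := fun q => (q.1.2, q.1.1, q.2))
      (Primrec.fst.comp Primrec.fst)
      ((Primrec.snd.comp Primrec.fst).pair ((Primrec.fst.comp Primrec.fst).pair Primrec.snd))
  exact Primrec.nat_findGreatest Primrec.fst h2

lemma computable_pi {α σ : Type*} [Primcodable α] [Primcodable σ] {n : ℕ} {f : α → Fin n → σ}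
    (hf : ∀ i, Computable fun a => f a i) : Computable f :=
  ((Primrec.vector_get' (n := n)).to_comp.comp (Computable.vector_ofFn hf)).of_eq fun a => by
    funext i; simp

lemma computable_apply {σ : Type*} [Primcodable σ] {n : ℕ} (i : Fin n) :
    Computable fun x : Fin n → σ => x i :=
  (Primrec.fin_app.comp Primrec.id (Primrec.const i)).to_comp

lemma computable_eval {n : ℕ} (p : PRSymbol n) : Computable p.eval := by
  induction p with
  | zero => exact Computable.const 0
  | succ => exact Computable.succ.comp (computable_apply 0)
  | proj i => exact computable_apply i
  | comp f g hf hg => exact hf.comp (computable_pi hg)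
  | @prec n f g hf hg =>
    have ht : Computable fun x : Fin (n + 1) → ℕ => Fin.tail x :=
      computable_pi fun i => computable_apply i.succ
    refine Computable.nat_rec (f := fun x : Fin (n + 1) → ℕ => x 0)
      (h := fun x q => g.eval (Fin.cons q.1 (Fin.cons q.2 (Fin.tail x))))
      (computable_apply 0) (hf.comp ht) (hg.comp (computable_pi fun i => ?_))
    refine Fin.cases ?_ (fun i => Fin.cases ?_ (fun i => ?_) i) i
    · exact Computable.fst.comp Computable.snd
    · exact Computable.snd.comp Computable.snd
    · exact (computable_apply i.succ).comp Computable.fst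

end Primrec

/-! ### Generated sequences and their closure properties -/

section Generated

variable {α β γ : Type*} [Primcodable α] [Primcodable β] [Primcodable γ]

/-- The sequence agrees, almost everywhere along the ultrafilter, with a partial recursive function
of one of the sequences `stageLim j`. -/
def Gen (ψ : ℕ → α) : Prop :=
  ∃ (j : ℕ) (φ : ℕ →. α), Partrec φ ∧ ∀ᶠ n in (hyperfilter ℕ : Filter ℕ), ψ n ∈ φ (stageLim j n)

lemma eventually_gt_hyperfilter (m : ℕ) : ∀ᶠ n in (hyperfilter ℕ : Filter ℕ), m < n :=
  Nat.hyperfilter_le_atTop (eventually_gt_atTop m)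

/-- Each iterate is the first component of the next one, so it can be computed back. This is why
`stageLim` pairs the halting bound with the old value. -/
lemma gen_of_le {ψ : ℕ → α} {j k : ℕ} (hjk : j ≤ k) {φ : ℕ →. α} (hφ : Partrec φ)
    (h : ∀ᶠ n in (hyperfilter ℕ : Filter ℕ), ψ n ∈ φ (stageLim j n)) :
    ∃ φ' : ℕ →. α, Partrec φ' ∧
      ∀ᶠ n in (hyperfilter ℕ : Filter ℕ), ψ n ∈ φ' (stageLim k n) := by
  induction hjk with
  | refl => exact ⟨φ, hφ, h⟩
  | step _ ih =>
    obtain ⟨φ', hφ', h'⟩ := ih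
    refine ⟨fun m => φ' m.unpair.1, hφ'.comp (Computable.fst.comp Computable.unpair), ?_⟩
    filter_upwards [h'] with n hn
    simpa [stageLim_succ] using hn

namespace Gen

lemma of_stageLim (j : ℕ) : Gen (stageLim j) :=
  ⟨j, Part.some, Partrec.some, Eventually.of_forall fun _ => Part.mem_some _⟩

lemma id : Gen fun n : ℕ => n := of_stageLim 0

lemma of_partrec {ψ : ℕ → α} (hψ : Gen ψ) {φ : α →. β} (hφ : Partrec φ) {χ : ℕ → β}
    (h : ∀ᶠ n in (hyperfilter ℕ : Filter ℕ), χ n ∈ φ (ψ n)) : Gen χ := by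
  obtain ⟨j, θ, hθ, hj⟩ := hψ
  refine ⟨j, fun m => (θ m).bind φ, hθ.bind (hφ.comp Computable.snd), ?_⟩
  filter_upwards [hj, h] with n h1 h2
  exact Part.mem_bind h1 h2

lemma map {ψ : ℕ → α} (hψ : Gen ψ) {f : α → β} (hf : Computable f) : Gen fun n => f (ψ n) :=
  hψ.of_partrec hf.partrec (Eventually.of_forall fun _ => Part.mem_some _)

lemma congr {ψ χ : ℕ → α} (hψ : Gen ψ) (h : ∀ᶠ n in (hyperfilter ℕ : Filter ℕ), χ n = ψ n) :
    Gen χ :=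
  hψ.of_partrec Partrec.some (h.mono fun n hn => by simp [hn])

lemma const (a : α) : Gen fun _ => a := id.map (Computable.const a)

lemma pair {ψ : ℕ → α} {χ : ℕ → β} (hψ : Gen ψ) (hχ : Gen χ) : Gen fun n => (ψ n, χ n) := by
  obtain ⟨i, φ, hφ, hi⟩ := hψ
  obtain ⟨j, θ, hθ, hj⟩ := hχ
  obtain ⟨φ', hφ', hi'⟩ := gen_of_le (le_max_left i j) hφ hi
  obtain ⟨θ', hθ', hj'⟩ := gen_of_le (le_max_right i j) hθ hj
  refine ⟨max i j, fun m => (φ' m).bind fun a => (θ' m).map fun b => (a, b),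
    hφ'.bind ((hθ'.comp Computable.fst).map
      ((Computable.snd.comp Computable.fst).pair Computable.snd)), ?_⟩
  filter_upwards [hi', hj'] with n h1 h2
  exact Part.mem_bind h1 (Part.mem_map _ h2)

lemma map₂ {ψ : ℕ → α} {χ : ℕ → β} (hψ : Gen ψ) (hχ : Gen χ) {f : α → β → γ}
    (hf : Computable₂ f) : Gen fun n => f (ψ n) (χ n) :=
  (hψ.pair hχ).map hf

lemma pi {m : ℕ} {ψ : Fin m → ℕ → α} (h : ∀ i, Gen (ψ i)) : Gen fun n i => ψ i n := by
  induction m with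
  | zero =>
    exact (const (fun i : Fin 0 => i.elim0)).congr (χ := fun n i => ψ i n)
      (Eventually.of_forall fun n => funext fun i => i.elim0)
  | succ m ih =>
    refine ((h 0).map₂ (ih fun i => h i.succ)
      (f := fun a x => (Fin.cons a x : Fin (m + 1) → α)) ?_).congr
      (Eventually.of_forall fun n => ?_)
    · refine computable_pi fun i => ?_
      refine Fin.cases ?_ (fun i => ?_) i
      · exact Computable.fst
      · exact (computable_apply i).comp Computable.snd
    · funext i
      refine Fin.cases ?_ (fun i => ?_) i <;> simp

/-- If `q` is computed from `stageLim j`, then `stageLim (j + 2)` bounds `q` and `stageLim (j + 3)`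
bounds the halting times of `c` on all inputs up to `q`. -/
lemma exists_evaln_bound {q : ℕ → ℕ} (hq : Gen q) (c : Code) : ∃ B, Gen B ∧
    ∀ᶠ n in (hyperfilter ℕ : Filter ℕ), ∀ m ≤ q n, ∀ y ∈ c.eval m, y ∈ Code.evaln (B n) c m := by
  obtain ⟨j, φ, hφ, hj⟩ := hq
  obtain ⟨d, rfl⟩ := Code.exists_code.1 (Partrec.nat_iff.1 hφ)
  refine ⟨SecondOrderPRA.stageLim (j + 3), of_stageLim _, ?_⟩
  filter_upwards [hj, eventually_gt_hyperfilter (encode c),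
    eventually_gt_hyperfilter (encode (Code.comp Code.succ d))] with n hn hc hd m hm y hy
  have hpos : ∀ i, 0 < SecondOrderPRA.stageLim i n := fun i =>
    (Nat.zero_le _).trans_lt (hc.trans_le (le_stageLim i n))
  -- A computation that halts within `s` stages of `evaln` has its inputs below `s`. Composing with
  -- the successor turns the output `q n` into such an input.
  have hq' : (q n).succ ∈ (Code.comp Code.succ d).eval (SecondOrderPRA.stageLim j n) := by
    exact Part.mem_bind hn (by simp [Code.eval])
  obtain ⟨t, ht⟩ := Code.evaln_complete.1 hq'
  have h1 := evaln_haltLim (hd.trans_le (le_stageLim (j + 1) n)) (lt_stageLim_succ (hpos j)) ht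
  have h2 : q n < SecondOrderPRA.stageLim (j + 2) n := by
    refine lt_of_lt_of_le ?_ (haltLim_stageLim_le (j + 1) n)
    revert h1
    generalize haltLim (SecondOrderPRA.stageLim (j + 1) n) = s
    intro h1
    cases s with
    | zero => simp [Code.evaln] at h1
    | succ s =>
      simp only [Code.evaln, Option.mem_def, Option.bind_eq_bind, Option.bind_eq_some_iff] at h1
      obtain ⟨_, -, a, -, _, hg, ha⟩ := h1
      have has : a ≤ s := by
        by_contra hcon
        simp [guard, hcon] at hg
      have : a.succ = (q n).succ := Option.some.inj ha
      omega
  obtain ⟨t, ht⟩ := Code.evaln_complete.1 hy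
  exact Code.evaln_mono (haltLim_stageLim_le (j + 2) n)
    (evaln_haltLim (hc.trans_le (le_stageLim _ n)) (hm.trans_lt h2) ht)

end Gen

end Generated

end SecondOrderPRA

namespace SecondOrderPRA

open Nat.Partrec (Code)
open Encodable Denumerable Filter

/-! ### Least undefined arguments and bounds for partial recursive functions -/

namespace Gen

variable {α β γ : Type*} [Primcodable α] [Primcodable β] [Primcodable γ]

lemma exists_value [Inhabited β] {ψ : ℕ → α} (hψ : Gen ψ) {φ : α →. β} (hφ : Partrec φ)
    (h : ∀ᶠ n in (hyperfilter ℕ : Filter ℕ), (φ (ψ n)).Dom) :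
    ∃ χ : ℕ → β, Gen χ ∧ ∀ᶠ n in (hyperfilter ℕ : Filter ℕ), χ n ∈ φ (ψ n) := by
  classical
  have h' : ∀ᶠ n in (hyperfilter ℕ : Filter ℕ),
      (if h : (φ (ψ n)).Dom then (φ (ψ n)).get h else default) ∈ φ (ψ n) := by
    filter_upwards [h] with n hn
    rw [dif_pos hn]
    exact Part.get_mem hn
  exact ⟨_, hψ.of_partrec hφ h', h'⟩

/-- The values at arguments up to `b` are all reached at a common stage. -/
lemma exists_stage {φ : α × ℕ →. β} (hφ : Partrec φ) {p : ℕ → α} (hp : Gen p) {b : ℕ → ℕ}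
    (hb : Gen b) : ∃ e : ℕ → α × ℕ → Option β, Computable₂ e ∧
      (∀ s x y, y ∈ e s x → y ∈ φ x) ∧ ∃ B, Gen B ∧
        ∀ᶠ n in (hyperfilter ℕ : Filter ℕ), ∀ m ≤ b n, ∀ y ∈ φ (p n, m), y ∈ e (B n) (p n, m) := by
  obtain ⟨c, hc⟩ := Code.exists_code.1 hφ
  have hval : ∀ x : α × ℕ, c.eval (encode x) = (φ x).map encode := fun x => by
    rw [hc]; simp
  obtain ⟨B, hB, hlt⟩ := Gen.exists_evaln_bound
    ((hp.map Computable.encode).map₂ hb Primrec₂.natPair.to_comp) c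
  refine ⟨fun s x => (Code.evaln s c (encode x)).bind decode, ?_, ?_, B, hB, ?_⟩
  · refine Computable.option_bind (Code.primrec_evaln.to_comp.comp
      ((Computable.fst.pair (Computable.const c)).pair (Computable.encode.comp Computable.snd)))
      (Computable.decode.comp Computable.snd).to₂
  · intro s x y hy
    obtain ⟨z, hz, hzy⟩ := Option.bind_eq_some_iff.1 (Option.mem_def.1 hy)
    have := Code.evaln_sound hz
    rw [hval] at this
    obtain ⟨y', hy', rfl⟩ := (Part.mem_map_iff _).1 this
    rw [encodek] at hzy
    exact Option.some.inj hzy ▸ hy'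
  · filter_upwards [hlt] with n hn m hm y hy
    -- Pairing is monotone, so one bound on codes covers all arguments `(p n, m)` with `m ≤ b n`.
    have hle : encode (p n, m) ≤ Nat.pair (encode (p n)) (b n) := by
      rw [encode_prod_val]
      rcases hm.eq_or_lt with h | h
      · rw [encode_nat, h]
      · exact (Nat.pair_lt_pair_right _ h).le
    have := hn _ hle (encode y) (by rw [hval]; exact Part.mem_map _ hy)
    rw [Option.mem_def, Option.bind_eq_some_iff]
    exact ⟨_, this, encodek y⟩

/-- If a partial recursive function is not defined at all arguments up to `b`, then the least
argument at which it is undefined is generated. -/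
lemma exists_least_undefined {φ : α × ℕ →. β} (hφ : Partrec φ) {p : ℕ → α} (hp : Gen p)
    {b : ℕ → ℕ} (hb : Gen b)
    (h : ¬ ∀ᶠ n in (hyperfilter ℕ : Filter ℕ), ∀ m ≤ b n, (φ (p n, m)).Dom) :
    ∃ x, Gen x ∧ ∀ᶠ n in (hyperfilter ℕ : Filter ℕ),
      x n ≤ b n ∧ ¬ (φ (p n, x n)).Dom ∧ ∀ m < x n, (φ (p n, m)).Dom := by
  obtain ⟨e, he, hsound, B, hB, hlt⟩ := exists_stage hφ hp hb
  -- At stage `B n` every relevant computation that halts has halted, so undefinedness is decidable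
  -- and its least instance can be searched for from `B n` and `p n`.
  let ψ : ℕ × α →. ℕ := fun q => Nat.rfind fun m => Part.some (e q.1 (q.2, m)).isNone
  have hψ : Partrec ψ := by
    have h1 : Computable fun r : (ℕ × α) × ℕ => e r.1.1 (r.1.2, r.2) := he.comp
      (Computable.fst.comp Computable.fst)
      ((Computable.snd.comp Computable.fst).pair Computable.snd)
    have h2 : Computable fun r : (ℕ × α) × ℕ => (e r.1.1 (r.1.2, r.2)).isNone :=
      (Primrec.not.to_comp.comp (Primrec.option_isSome.to_comp.comp h1)).of_eq fun r => by simp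
    exact Partrec.rfind h2.partrec.to₂
  rw [← Ultrafilter.eventually_not] at h
  have key : ∀ᶠ n in (hyperfilter ℕ : Filter ℕ), ∃ x ∈ ψ (B n, p n),
      x ≤ b n ∧ ¬ (φ (p n, x)).Dom ∧ ∀ m < x, (φ (p n, m)).Dom := by
    filter_upwards [h, hlt] with n hn hlt
    push Not at hn
    obtain ⟨m, hm, hmd⟩ := hn
    have hnone : (e (B n) (p n, m)).isNone = true := by
      rw [Option.isNone_iff_eq_none, Option.eq_none_iff_forall_not_mem]
      exact fun y hy => hmd (Part.dom_iff_mem.2 ⟨y, hsound _ _ _ hy⟩)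
    obtain ⟨x, hx, hxm⟩ := Nat.rfind_min' (p := fun m => (e (B n) (p n, m)).isNone) hnone
    refine ⟨x, hx, hxm.trans hm, fun hd => ?_, fun k hk => ?_⟩
    · obtain ⟨y, hy⟩ := Part.dom_iff_mem.1 hd
      have h1 := hlt x (hxm.trans hm) y hy
      have h2 : true = (e (B n) (p n, x)).isNone := Part.mem_some_iff.1 (Nat.rfind_spec hx)
      rw [Option.mem_def.1 h1] at h2
      exact absurd h2 (by simp)
    · have h2 : false = (e (B n) (p n, k)).isNone := Part.mem_some_iff.1 (Nat.rfind_min hx hk)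
      obtain ⟨y, hy⟩ : ∃ y, e (B n) (p n, k) = some y := by
        rw [← Option.isSome_iff_exists, ← Option.not_isNone, ← h2]; rfl
      exact Part.dom_iff_mem.2 ⟨y, hsound _ _ _ hy⟩
  obtain ⟨x, hx, hxmem⟩ := (hB.pair hp).exists_value hψ
    (key.mono fun n ⟨x, hx, _⟩ => Part.dom_iff_mem.2 ⟨x, hx⟩)
  refine ⟨x, hx, ?_⟩
  filter_upwards [key, hxmem] with n ⟨x', hx', h'⟩ hn
  rwa [Part.mem_unique hn hx']

/-- A partial recursive function that is defined at all generated arguments is defined at all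
arguments below a generated one. -/
lemma forall_le_dom {φ : α × ℕ →. β} (hφ : Partrec φ) {p : ℕ → α} (hp : Gen p)
    (h : ∀ x, Gen x → ∀ᶠ n in (hyperfilter ℕ : Filter ℕ), (φ (p n, x n)).Dom)
    {b : ℕ → ℕ} (hb : Gen b) :
    ∀ᶠ n in (hyperfilter ℕ : Filter ℕ), ∀ m ≤ b n, (φ (p n, m)).Dom := by
  by_contra hcon
  obtain ⟨x, hx, hlt⟩ := exists_least_undefined hφ hp hb hcon
  obtain ⟨n, h1, h2⟩ := ((h x hx).and hlt).exists
  exact h2.2.1 h1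

/-- The values of a partial recursive function at arguments up to `b` are bounded. -/
lemma exists_value_bound {φ : α × ℕ →. ℕ} (hφ : Partrec φ) {p : ℕ → α} (hp : Gen p) {b : ℕ → ℕ}
    (hb : Gen b) : ∃ B, Gen B ∧
      ∀ᶠ n in (hyperfilter ℕ : Filter ℕ), ∀ m ≤ b n, ∀ y ∈ φ (p n, m), y ≤ B n := by
  obtain ⟨e, he, -, B, hB, hlt⟩ := exists_stage hφ hp hb
  -- The running maximum of the values found at the common stage, with 0 for undefined ones.
  let f : (ℕ × α) × ℕ → ℕ := fun q =>
    Nat.rec 0 (fun m r => max r ((e q.1.1 (q.1.2, m)).getD 0)) (q.2 + 1)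
  have hf : Computable f := by
    refine Computable.nat_rec (f := fun q : (ℕ × α) × ℕ => q.2 + 1)
      (h := fun q r => max r.2 ((e q.1.1 (q.1.2, r.1)).getD 0))
      (Computable.succ.comp Computable.snd) (Computable.const 0) ?_
    refine (Primrec.nat_max.to_comp).comp (Computable.snd.comp Computable.snd)
      (Computable.option_getD (he.comp ?_ (Computable.pair ?_ ?_)) (Computable.const 0))
    · exact Computable.fst.comp (Computable.fst.comp Computable.fst)
    · exact Computable.snd.comp (Computable.fst.comp Computable.fst)
    · exact Computable.fst.comp Computable.snd
  refine ⟨_, ((hB.pair hp).pair hb).map hf, ?_⟩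
  filter_upwards [hlt] with n hn m hm y hy
  have hle : ∀ k, m < k → y ≤
      (Nat.rec 0 (fun m r => max r ((e (B n) (p n, m)).getD 0)) k : ℕ) := by
    intro k hk
    induction hk with
    | refl =>
      refine le_trans ?_ (le_max_right _ _)
      rw [Option.mem_def.1 (hn m hm y hy)]
      rfl
    | step _ ih => exact ih.trans (le_max_left _ _)
  exact hle _ (Nat.lt_succ_of_le hm)

end Gen

/-! ### Numbers and recursive functions of the second model -/

/-- The numbers of the model: generated sequences modulo the ultrafilter. -/
def GenNum : Type := {g : Germ (hyperfilter ℕ : Filter ℕ) ℕ // ∃ ψ : ℕ → ℕ, Gen ψ ∧ ↑ψ = g}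

namespace GenNum

/-- A sequence that represents the number. -/
noncomputable def rep (a : GenNum) : ℕ → ℕ := a.2.choose

lemma gen_rep (a : GenNum) : Gen a.rep := a.2.choose_spec.1

lemma coe_rep (a : GenNum) : (↑a.rep : Germ (hyperfilter ℕ : Filter ℕ) ℕ) = a.1 :=
  a.2.choose_spec.2

/-- The number represented by a generated sequence. -/
noncomputable def mk (ψ : ℕ → ℕ) (h : Gen ψ) : GenNum := ⟨↑ψ, ψ, h, rfl⟩

lemma rep_mk {ψ : ℕ → ℕ} (h : Gen ψ) :
    ∀ᶠ n in (hyperfilter ℕ : Filter ℕ), (mk ψ h).rep n = ψ n :=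
  Germ.coe_eq.1 (coe_rep (mk ψ h))

lemma eq_iff {a b : GenNum} : a = b ↔ ∀ᶠ n in (hyperfilter ℕ : Filter ℕ), a.rep n = b.rep n := by
  refine ⟨fun h => Eventually.of_forall fun n => by rw [h], fun h => Subtype.ext ?_⟩
  rw [← coe_rep, ← coe_rep]
  exact Germ.coe_eq.2 h

noncomputable instance : Inhabited GenNum := ⟨mk _ (Gen.const 0)⟩

/-- The componentwise representation of a tuple. -/
noncomputable def tuple {n : ℕ} (x : Fin n → GenNum) (i : ℕ) : Fin n → ℕ := fun j => (x j).rep i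

lemma gen_tuple {n : ℕ} (x : Fin n → GenNum) : Gen (tuple x) := Gen.pi fun j => (x j).gen_rep

lemma tuple_cons {n : ℕ} (a : GenNum) (x : Fin n → GenNum) (i : ℕ) :
    tuple (Fin.cons a x : Fin (n + 1) → GenNum) i = Fin.cons (a.rep i) (tuple x i) := by
  funext j
  refine Fin.cases ?_ (fun j => ?_) j <;> simp [tuple]

lemma tuple_congr {n : ℕ} {x : Fin n → GenNum} {ψ : Fin n → ℕ → ℕ}
    (h : ∀ j, ∀ᶠ i in (hyperfilter ℕ : Filter ℕ), (x j).rep i = ψ j i) :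
    ∀ᶠ i in (hyperfilter ℕ : Filter ℕ), tuple x i = fun j => ψ j i :=
  (eventually_all.2 h).mono fun _ hi => funext hi

/-- The extension of a computable function to the model. -/
noncomputable def lift {n : ℕ} (f : (Fin n → ℕ) → ℕ) (hf : Computable f) (x : Fin n → GenNum) :
    GenNum := mk _ ((gen_tuple x).map hf)

lemma rep_lift {n : ℕ} {f : (Fin n → ℕ) → ℕ} (hf : Computable f) (x : Fin n → GenNum) :
    ∀ᶠ i in (hyperfilter ℕ : Filter ℕ), (lift f hf x).rep i = f (tuple x i) :=
  rep_mk _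

/-- The function is given by a partial recursive function and a parameter. -/
def IsRec {n : ℕ} (F : (Fin n → GenNum) → GenNum) : Prop :=
  ∃ φ : ℕ × (Fin n → ℕ) →. ℕ, Partrec φ ∧ ∃ p : ℕ → ℕ, Gen p ∧
    ∀ x, ∀ᶠ i in (hyperfilter ℕ : Filter ℕ), (F x).rep i ∈ φ (p i, tuple x i)

lemma IsRec.intro {α : Type*} [Primcodable α] {n : ℕ} {F : (Fin n → GenNum) → GenNum}
    {φ : α × (Fin n → ℕ) →. ℕ} (hφ : Partrec φ) {p : ℕ → α} (hp : Gen p)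
    (h : ∀ x, ∀ᶠ i in (hyperfilter ℕ : Filter ℕ), (F x).rep i ∈ φ (p i, tuple x i)) :
    IsRec F := by
  refine ⟨fun q => (decode (α := α) q.1 : Part α).bind fun a => φ (a, q.2), ?_, _,
    hp.map Computable.encode, fun x => ?_⟩
  · exact (Computable.ofOption (Computable.decode.comp Computable.fst)).bind
      (hφ.comp (Computable.snd.pair (Computable.snd.comp Computable.fst)))
  · filter_upwards [h x] with i hi
    simpa using hi

/-- Only definedness at tuples of numbers of the model is required; the values are then generated,
hence themselves numbers of the model. -/
lemma exists_isRec {α : Type*} [Primcodable α] {n : ℕ} {φ : α × (Fin n → ℕ) →. ℕ}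
    (hφ : Partrec φ) {p : ℕ → α} (hp : Gen p)
    (h : ∀ x, ∀ᶠ i in (hyperfilter ℕ : Filter ℕ), (φ (p i, tuple x i)).Dom) :
    ∃ F : (Fin n → GenNum) → GenNum, IsRec F ∧
      ∀ x, ∀ᶠ i in (hyperfilter ℕ : Filter ℕ), (F x).rep i ∈ φ (p i, tuple x i) := by
  have h' : ∀ x : Fin n → GenNum, ∃ a : GenNum,
      ∀ᶠ i in (hyperfilter ℕ : Filter ℕ), a.rep i ∈ φ (p i, tuple x i) := fun x => by
    obtain ⟨χ, hχ, hmem⟩ := (hp.pair (gen_tuple x)).exists_value hφ (h x)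
    refine ⟨mk χ hχ, ?_⟩
    filter_upwards [rep_mk hχ, hmem] with i h1 h2
    rwa [h1]
  choose F hF using h'
  exact ⟨F, IsRec.intro hφ hp hF, hF⟩

lemma isRec_lift {n : ℕ} {f : (Fin n → ℕ) → ℕ} (hf : Computable f) : IsRec (lift f hf) :=
  IsRec.intro (φ := fun q : ℕ × (Fin n → ℕ) => Part.some (f q.2))
    (hf.comp Computable.snd).partrec (Gen.const 0) fun x => by
      filter_upwards [rep_lift hf x] with i hi
      simp [hi]

lemma isRec_const {n : ℕ} (a : GenNum) : IsRec fun _ : Fin n → GenNum => a :=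
  IsRec.intro (φ := fun q : ℕ × (Fin n → ℕ) => Part.some q.1) Computable.fst.partrec a.gen_rep
    fun _ => Eventually.of_forall fun _ => Part.mem_some _

lemma isRec_proj {n : ℕ} (j : Fin n) : IsRec fun x : Fin n → GenNum => x j :=
  IsRec.intro (φ := fun q : ℕ × (Fin n → ℕ) => Part.some (q.2 j))
    ((computable_apply j).comp Computable.snd).partrec (Gen.const 0)
    fun _ => Eventually.of_forall fun _ => Part.mem_some _

lemma IsRec.comp {m n : ℕ} {f : (Fin m → GenNum) → GenNum} (hf : IsRec f)
    {g : Fin m → (Fin n → GenNum) → GenNum} (hg : ∀ j, IsRec (g j)) :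
    IsRec fun x => f fun j => g j x := by
  obtain ⟨φ, hφ, p, hp, hfφ⟩ := hf
  choose θ hθ q hq hgθ using hg
  refine IsRec.intro (φ := fun r : (ℕ × (Fin m → ℕ)) × (Fin n → ℕ) =>
    (List.Vector.mOfFn fun j => θ j (r.1.2 j, r.2)).bind fun v => φ (r.1.1, v.get)) ?_
    (hp.pair (Gen.pi hq)) fun x => ?_
  · refine (Partrec.vector_mOfFn fun j => (hθ j).comp (((computable_apply j).comp
      (Computable.snd.comp Computable.fst)).pair Computable.snd)).bind (hφ.comp ?_)
    exact (Computable.fst.comp (Computable.fst.comp Computable.fst)).pair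
      (Primrec.vector_get'.to_comp.comp Computable.snd)
  · filter_upwards [hfφ fun j => g j x, eventually_all.2 fun j => hgθ j x] with i h1 h2
    have h3 : (fun j => θ j (q j i, tuple x i)) = fun j => Part.some ((g j x).rep i) :=
      funext fun j => Part.eq_some_iff.2 (h2 j)
    simp only [h3, Vector.mOfFn_part_some, Part.bind_some]
    have h4 : (List.Vector.ofFn fun j => (g j x).rep i).get = tuple (fun j => g j x) i := by
      funext j; simp [tuple]
    rwa [h4]

end GenNum

end SecondOrderPRA

namespace SecondOrderPRA

open Encodable Denumerable Filter

namespace GenNum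

/-- The recursion is run pointwise by a partial recursive function, and only its definedness at
non-standard arguments needs an argument. -/
lemma IsRec.prec {n : ℕ} {f : (Fin n → GenNum) → GenNum} (hf : IsRec f)
    {g : (Fin (n + 2) → GenNum) → GenNum} (hg : IsRec g) :
    ∃ h : (Fin (n + 1) → GenNum) → GenNum, IsRec h ∧
      (∀ (a : GenNum) (x : Fin n → GenNum),
        (∀ᶠ i in (hyperfilter ℕ : Filter ℕ), a.rep i = 0) →
        h (Fin.cons a x : Fin (n + 1) → GenNum) = f x) ∧
      ∀ (a b : GenNum) (x : Fin n → GenNum),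
        (∀ᶠ i in (hyperfilter ℕ : Filter ℕ), b.rep i = a.rep i + 1) →
        h (Fin.cons b x : Fin (n + 1) → GenNum) =
        g (Fin.cons a (Fin.cons (h (Fin.cons a x : Fin (n + 1) → GenNum))
          x : Fin (n + 1) → GenNum) : Fin (n + 2) → GenNum) := by
  obtain ⟨φ, hφ, p, hp, hfφ⟩ := hf
  obtain ⟨θ, hθ, q, hq, hgθ⟩ := hg
  let ρ : ((ℕ × ℕ) × (Fin n → ℕ)) × ℕ →. ℕ := fun r =>
    Nat.rec (φ (r.1.1.1, r.1.2)) (fun t s => s.bind fun v =>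
      θ (r.1.1.2, (Fin.cons t (Fin.cons v r.1.2 : Fin (n + 1) → ℕ) : Fin (n + 2) → ℕ))) r.2
  have hρ : Partrec ρ := by
    refine Partrec.nat_rec (f := fun r : ((ℕ × ℕ) × (Fin n → ℕ)) × ℕ => r.2)
      (g := fun r => φ (r.1.1.1, r.1.2))
      (h := fun r s => θ (r.1.1.2,
        (Fin.cons s.1 (Fin.cons s.2 r.1.2 : Fin (n + 1) → ℕ) : Fin (n + 2) → ℕ)))
      Computable.snd ?_ ?_
    · exact hφ.comp ((Computable.fst.comp (Computable.fst.comp Computable.fst)).pair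
        (Computable.snd.comp Computable.fst))
    · refine hθ.comp (Computable.pair ?_ (computable_pi fun i => ?_))
      · exact Computable.snd.comp (Computable.fst.comp (Computable.fst.comp Computable.fst))
      · refine Fin.cases ?_ (fun i => Fin.cases ?_ (fun i => ?_) i) i
        · exact Computable.fst.comp Computable.snd
        · exact Computable.snd.comp Computable.snd
        · exact (computable_apply i).comp
            (Computable.snd.comp (Computable.fst.comp Computable.fst))
  have hρ0 : ∀ r, ρ (r, 0) = φ (r.1.1, r.2) := fun _ => rfl
  have hρs : ∀ r t, ρ (r, t + 1) = (ρ (r, t)).bind fun v =>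
    θ (r.1.2, (Fin.cons t (Fin.cons v r.2 : Fin (n + 1) → ℕ) : Fin (n + 2) → ℕ)) := fun _ _ => rfl
  -- The least undefined argument `t` would be generated. It is not 0 since `f` is total on the
  -- model. Otherwise the value at `t - 1` is a number of the model, and totality of `g` there gives
  -- the value at `t`.
  have hdom : ∀ (x : Fin n → GenNum) (a : ℕ → ℕ), Gen a →
      ∀ᶠ i in (hyperfilter ℕ : Filter ℕ), (ρ (((p i, q i), tuple x i), a i)).Dom := by
    intro x a ha
    have hpq : Gen fun i => ((p i, q i), tuple x i) := (hp.pair hq).pair (gen_tuple x)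
    by_contra hcon
    obtain ⟨t, ht, hlt⟩ := Gen.exists_least_undefined hρ hpq ha fun h => hcon
      (h.mono fun i hi => hi _ le_rfl)
    rcases Ultrafilter.eventually_or.1 (Eventually.of_forall fun i => Nat.eq_zero_or_pos (t i))
      with h0 | h0
    · obtain ⟨i, hi, hlt, hf⟩ := (h0.and (hlt.and (hfφ x))).exists
      rw [hi, hρ0] at hlt
      exact hlt.2.1 (Part.dom_iff_mem.2 ⟨_, hf⟩)
    · have hs : Gen fun i => t i - 1 := ht.map Primrec.pred.to_comp
      obtain ⟨v, hv, hmem⟩ := (hpq.pair hs).exists_value hρ (by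
        filter_upwards [hlt, h0] with i h1 h2
        exact h1.2.2 _ (Nat.sub_lt h2 one_pos))
      obtain ⟨i, h1, h2, h3, h4, h5, h6⟩ := (h0.and (hlt.and (hmem.and ((rep_mk hs).and
        ((rep_mk hv).and (hgθ (Fin.cons (mk _ hs) (Fin.cons (mk v hv) x)))))))).exists
      rw [tuple_cons, tuple_cons, h4, h5] at h6
      refine h2.2.1 ?_
      have : t i = t i - 1 + 1 := by omega
      rw [this, hρs]
      exact Part.dom_iff_mem.2 ⟨_, Part.mem_bind h3 h6⟩
  obtain ⟨h, hh, hval⟩ := exists_isRec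
    (φ := fun r : (ℕ × ℕ) × (Fin (n + 1) → ℕ) => ρ ((r.1, Fin.tail r.2), r.2 0))
    (hρ.comp ((Computable.fst.pair (computable_pi fun i =>
      (computable_apply i.succ).comp Computable.snd)).pair
      ((computable_apply 0).comp Computable.snd)))
    (hp.pair hq) (fun x => hdom (Fin.tail x) (x 0).rep (x 0).gen_rep)
  have hval' : ∀ a (x : Fin n → GenNum), ∀ᶠ i in (hyperfilter ℕ : Filter ℕ),
      (h (Fin.cons a x : Fin (n + 1) → GenNum)).rep i ∈
        ρ (((p i, q i), tuple x i), a.rep i) := fun a x => by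
    filter_upwards [hval (Fin.cons a x)] with i hi
    rw [tuple_cons] at hi
    exact hi
  refine ⟨h, hh, fun a x ha => eq_iff.2 ?_, fun a b x hb => eq_iff.2 ?_⟩
  · filter_upwards [ha, hval' a x, hfφ x] with i h1 h2 h3
    rw [h1, hρ0] at h2
    exact Part.mem_unique h2 h3
  · filter_upwards [hb, hval' a x, hval' b x, hgθ (Fin.cons a (Fin.cons
      (h (Fin.cons a x : Fin (n + 1) → GenNum)) x))] with i h1 h2 h3 h4
    rw [h1, hρs] at h3
    rw [tuple_cons, tuple_cons] at h4
    exact Part.mem_unique h3 (Part.mem_bind h2 h4)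

/-- The least zero of a recursive function in its last argument, where there is one. -/
lemma IsRec.exists_min {χ : (Fin 2 → GenNum) → GenNum} (hχ : IsRec χ) :
    ∃ φ : ℕ × ℕ →. ℕ, Partrec φ ∧ ∃ p : ℕ → ℕ, Gen p ∧ ∀ a b : GenNum,
      (∀ᶠ i in (hyperfilter ℕ : Filter ℕ), (χ ![a, b]).rep i = 0) →
      ∃ m : GenNum, (∀ᶠ i in (hyperfilter ℕ : Filter ℕ), m.rep i ∈ φ (p i, a.rep i)) ∧
        (∀ᶠ i in (hyperfilter ℕ : Filter ℕ), m.rep i ≤ b.rep i) ∧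
        (∀ᶠ i in (hyperfilter ℕ : Filter ℕ), (χ ![a, m]).rep i = 0) ∧
        ∀ c : GenNum, (∀ᶠ i in (hyperfilter ℕ : Filter ℕ), c.rep i < m.rep i) →
          ∀ᶠ i in (hyperfilter ℕ : Filter ℕ), (χ ![a, c]).rep i ≠ 0 := by
  obtain ⟨θ, hθ, p, hp, hval⟩ := hχ
  have htuple : ∀ (a b : GenNum) i, tuple ![a, b] i = ![a.rep i, b.rep i] := fun a b i => by
    funext j; fin_cases j <;> rfl
  let ρ : (ℕ × ℕ) × ℕ →. ℕ := fun r => θ (r.1.1, ![r.1.2, r.2])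
  have hρ : Partrec ρ := hθ.comp ((Computable.fst.comp Computable.fst).pair
    (computable_pi fun i => by
      fin_cases i
      · exact Computable.snd.comp Computable.fst
      · exact Computable.snd))
  let φ : ℕ × ℕ →. ℕ := fun r => Nat.rfind fun m => (ρ (r, m)).map fun v => decide (v = 0)
  have hφ : Partrec φ := by
    have h1 : Computable fun v : ℕ => decide (v = 0) :=
      (PrimrecPred.decide (Primrec.eq.comp Primrec.id (Primrec.const 0))).to_comp
    exact Partrec.rfind (hρ.map (h1.comp Computable.snd).to₂).to₂
  refine ⟨φ, hφ, p, hp, fun a b hb => ?_⟩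
  have hval' : ∀ c : GenNum, ∀ᶠ i in (hyperfilter ℕ : Filter ℕ),
      (χ ![a, c]).rep i ∈ ρ ((p i, a.rep i), c.rep i) := fun c => by
    filter_upwards [hval ![a, c]] with i hi
    rwa [htuple] at hi
  have hpa := hp.pair a.gen_rep
  -- The unbounded search for a zero converges only if all earlier values exist at almost every
  -- index, simultaneously; totality on the model gives this.
  have hdom := Gen.forall_le_dom hρ hpa (fun x hx => by
    filter_upwards [hval' (mk x hx), rep_mk hx] with i h1 h2
    rw [h2] at h1
    exact Part.dom_iff_mem.2 ⟨_, h1⟩) b.gen_rep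
  have hmem0 : ∀ᶠ i in (hyperfilter ℕ : Filter ℕ), ∃ m ∈ φ (p i, a.rep i), m ≤ b.rep i := by
    filter_upwards [hb, hval' b, hdom] with i h1 h2 h3
    rw [h1] at h2
    have htrue : true ∈ (ρ ((p i, a.rep i), b.rep i)).map fun v => decide (v = 0) :=
      (Part.mem_map_iff _).2 ⟨0, h2, by simp⟩
    obtain ⟨m, hm⟩ := Part.dom_iff_mem.1 ((Nat.rfind_dom' (p := fun m =>
      (ρ ((p i, a.rep i), m)).map fun v => decide (v = 0))).2 ⟨b.rep i, htrue, fun h => h3 _ h⟩)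
    refine ⟨m, hm, ?_⟩
    by_contra hlt
    exact absurd (Part.mem_unique htrue (Nat.rfind_min hm (not_le.1 hlt))) (by simp)
  obtain ⟨m, hm, hmem⟩ := hpa.exists_value hφ
    (hmem0.mono fun i ⟨m, hm, _⟩ => Part.dom_iff_mem.2 ⟨m, hm⟩)
  have hmem' : ∀ᶠ i in (hyperfilter ℕ : Filter ℕ), (mk m hm).rep i ∈ φ (p i, a.rep i) := by
    filter_upwards [hmem, rep_mk hm] with i h1 h2
    rwa [h2]
  refine ⟨mk m hm, hmem', ?_, ?_, fun c hc => ?_⟩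
  · filter_upwards [hmem', hmem0] with i h1 ⟨m', h2, h3⟩
    rwa [Part.mem_unique h1 h2]
  · filter_upwards [hmem', hval' (mk m hm)] with i h1 h2
    obtain ⟨v, hv, hv0⟩ := (Part.mem_map_iff _).1 (Nat.rfind_spec h1)
    rw [Part.mem_unique h2 hv]
    simpa using hv0
  · filter_upwards [hmem', hval' c, hc] with i h1 h2 h3
    obtain ⟨v, hv, hv0⟩ := (Part.mem_map_iff _).1 (Nat.rfind_min h1 h3)
    rw [Part.mem_unique h2 hv]
    simpa using hv0

end GenNum

/-! ### The model of generated numbers satisfies `RCA₀` -/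

open GenNum

/-- The model of generated numbers and recursive functions. -/
noncomputable abbrev genModel : Model where
  carrier := GenNum
  sym p := lift p.eval (computable_eval p)
  lt a b := ∀ᶠ i in (hyperfilter ℕ : Filter ℕ), a.rep i < b.rep i
  Fun _ := {F | IsRec F}
  fun_nonempty _ := ⟨_, isRec_const default⟩

lemma rep_zero : ∀ᶠ i in (hyperfilter ℕ : Filter ℕ), GenNum.rep genModel.zero i = 0 :=
  rep_lift (computable_eval .zero) _

lemma rep_succ (a : GenNum) :
    ∀ᶠ i in (hyperfilter ℕ : Filter ℕ), GenNum.rep (genModel.succ a) i = a.rep i + 1 :=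
  rep_lift (computable_eval .succ) _

lemma rep_numeral (k : ℕ) :
    ∀ᶠ i in (hyperfilter ℕ : Filter ℕ), GenNum.rep (genModel.numeral k) i = k := by
  induction k with
  | zero => exact rep_zero
  | succ k ih =>
    filter_upwards [ih, rep_succ (genModel.numeral k)] with i h1 h2
    exact h2.trans (congrArg Nat.succ h1)

lemma eq_zero_iff (a : GenNum) :
    a = genModel.zero ↔ ∀ᶠ i in (hyperfilter ℕ : Filter ℕ), a.rep i = 0 := by
  rw [eq_iff]
  exact ⟨fun h => by filter_upwards [h, rep_zero] with i h1 h2 using h1.trans h2,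
    fun h => by filter_upwards [h, rep_zero] with i h1 h2 using h1.trans h2.symm⟩

lemma lift_eq_zero_iff {n : ℕ} {f : (Fin n → ℕ) → ℕ} (hf : Computable f) (x : Fin n → GenNum) :
    lift f hf x = genModel.zero ↔
      ∀ᶠ i in (hyperfilter ℕ : Filter ℕ), f (tuple x i) = 0 := by
  rw [eq_zero_iff]
  exact ⟨fun h => by filter_upwards [h, rep_lift hf x] with i h1 h2 using h2 ▸ h1,
    fun h => by filter_upwards [h, rep_lift hf x] with i h1 h2 using h2.trans h1⟩

lemma isRec_eval (v : Assignment genModel) (i j : ℕ) (t : Term) :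
    IsRec fun x : Fin 2 → GenNum => t.eval ((v.setNum i (x 0)).setNum j (x 1)) := by
  induction t with
  | var k =>
    simp only [Term.eval, Assignment.setNum_num]
    split_ifs
    · exact isRec_proj 1
    · exact isRec_proj 0
    · exact isRec_const _
  | sym p t ih => exact (isRec_lift (computable_eval p)).comp ih
  | app n f t ih => exact IsRec.comp (v.func n f).2 ih

lemma primrec_apply {n : ℕ} (j : Fin n) : Primrec fun x : Fin n → ℕ => x j :=
  Primrec.fin_app.comp Primrec.id (Primrec.const j)

/-- Quantifier-free formulae have recursive characteristic functions. -/
lemma exists_isRec_holds (v : Assignment genModel) (i j : ℕ) (θ : QF) :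
    ∃ χ : (Fin 2 → GenNum) → GenNum, IsRec χ ∧
      ∀ x, χ x = genModel.zero ↔ θ.Holds ((v.setNum i (x 0)).setNum j (x 1)) := by
  have comp₂ : ∀ {f : (Fin 2 → ℕ) → ℕ} (_ : Computable f) {g h : (Fin 2 → GenNum) → GenNum},
      IsRec g → IsRec h → ∃ χ : (Fin 2 → GenNum) → GenNum, IsRec χ ∧ ∀ x, χ x = genModel.zero ↔
        ∀ᶠ i in (hyperfilter ℕ : Filter ℕ), f ![(g x).rep i, (h x).rep i] = 0 := by
    intro f hf g h hg hh
    refine ⟨_, (isRec_lift hf).comp (g := ![g, h]) (fun k => by fin_cases k <;> assumption),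
      fun x => ?_⟩
    have : ∀ i, tuple (fun k => (![g, h] : Fin 2 → _) k x) i = ![(g x).rep i, (h x).rep i] :=
      fun i => by funext k; fin_cases k <;> rfl
    rw [lift_eq_zero_iff]
    simp only [this]
  have hc : ∀ {c : (Fin 2 → ℕ) → Prop} [DecidablePred c], PrimrecPred c → ∀ a b : ℕ,
      Computable fun x : Fin 2 → ℕ => if c x then a else b := fun hc a b =>
    (Primrec.ite hc (Primrec.const a) (Primrec.const b)).to_comp
  have h0 : Primrec fun x : Fin 2 → ℕ => x 0 := primrec_apply 0
  have h1 : Primrec fun x : Fin 2 → ℕ => x 1 := primrec_apply 1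
  -- Negation and disjunction pass through the quantifier "almost everywhere" because the filter is
  -- an ultrafilter, as in Łoś's theorem.
  have hneg : ∀ {χ : (Fin 2 → GenNum) → GenNum} {P : (Fin 2 → GenNum) → Prop}, IsRec χ →
      (∀ x, χ x = genModel.zero ↔ P x) → ∃ χ' : (Fin 2 → GenNum) → GenNum, IsRec χ' ∧
        ∀ x, χ' x = genModel.zero ↔ ¬ P x := by
    intro χ P hχ hP
    obtain ⟨χ', h, h'⟩ := comp₂ (hc (Primrec.eq.comp h0 (Primrec.const 0)) 1 0) hχ hχ
    refine ⟨χ', h, fun x => ?_⟩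
    rw [h', ← hP, eq_zero_iff, ← Ultrafilter.eventually_not]
    refine eventually_congr (Eventually.of_forall fun i => ?_)
    by_cases h : (χ x).rep i = 0 <;> simp [h]
  have hor : ∀ {χ χ' : (Fin 2 → GenNum) → GenNum} {P P' : (Fin 2 → GenNum) → Prop}, IsRec χ →
      (∀ x, χ x = genModel.zero ↔ P x) → IsRec χ' → (∀ x, χ' x = genModel.zero ↔ P' x) →
      ∃ χ'' : (Fin 2 → GenNum) → GenNum, IsRec χ'' ∧
        ∀ x, χ'' x = genModel.zero ↔ P x ∨ P' x := by
    intro χ χ' P P' hχ hP hχ' hP'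
    obtain ⟨χ'', h, h'⟩ := comp₂ (Primrec.nat_mul.comp h0 h1).to_comp hχ hχ'
    refine ⟨χ'', h, fun x => ?_⟩
    rw [h', ← hP, ← hP', eq_zero_iff, eq_zero_iff, ← Ultrafilter.eventually_or]
    simp
  induction θ with
  | eq t u =>
    obtain ⟨χ, h, h'⟩ := comp₂ (hc (Primrec.eq.comp h0 h1) 0 1) (isRec_eval v i j t)
      (isRec_eval v i j u)
    refine ⟨χ, h, fun x => (h' x).trans ?_⟩
    simp only [QF.Holds]
    rw [eq_iff]
    simp
  | lt t u =>
    obtain ⟨χ, h, h'⟩ := comp₂ (hc (Primrec.nat_lt.comp h0 h1) 0 1) (isRec_eval v i j t)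
      (isRec_eval v i j u)
    refine ⟨χ, h, fun x => (h' x).trans ?_⟩
    simp [QF.Holds]
  | neg θ ih =>
    obtain ⟨χ, h, h'⟩ := ih
    exact hneg h h'
  | and θ η ih ih' =>
    obtain ⟨χ, h, h'⟩ := ih
    obtain ⟨χ', h₁, h₁'⟩ := ih'
    obtain ⟨χ'', h₂, h₂'⟩ := comp₂ (Primrec.nat_add.comp h0 h1).to_comp h h₁
    refine ⟨χ'', h₂, fun x => ?_⟩
    rw [h₂', QF.Holds, ← h', ← h₁', eq_zero_iff, eq_zero_iff, ← eventually_and]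
    simp
  | or θ η ih ih' =>
    obtain ⟨χ, h, h'⟩ := ih
    obtain ⟨χ', h₁, h₁'⟩ := ih'
    exact hor h h' h₁ h₁'
  | imp θ η ih ih' =>
    obtain ⟨χ, h, h'⟩ := ih
    obtain ⟨χ', h₁, h₁'⟩ := ih'
    obtain ⟨χn, hn, hn'⟩ := hneg h h'
    obtain ⟨χ'', h₂, h₂'⟩ := hor hn hn' h₁ h₁'
    exact ⟨χ'', h₂, fun x => (h₂' x).trans imp_iff_not_or.symm⟩

end SecondOrderPRA

namespace SecondOrderPRA

open Encodable Denumerable Filter GenNum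

lemma genModel_lt_total (a b : GenNum) : genModel.lt a b ∨ a = b ∨ genModel.lt b a := by
  rw [eq_iff]
  change (∀ᶠ i in (hyperfilter ℕ : Filter ℕ), a.rep i < b.rep i) ∨ _ ∨
    ∀ᶠ i in (hyperfilter ℕ : Filter ℕ), b.rep i < a.rep i
  rw [← Ultrafilter.eventually_or, ← Ultrafilter.eventually_or]
  exact Eventually.of_forall fun i => lt_trichotomy _ _

lemma genModel_eq_zero_or_succ (a : GenNum) :
    a = genModel.zero ∨ ∃ b, genModel.lt b a ∧ a = genModel.succ b := by
  rcases Ultrafilter.eventually_or.1 (Eventually.of_forall fun i => Nat.eq_zero_or_pos (a.rep i))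
    with h | h
  · exact Or.inl ((eq_zero_iff a).2 h)
  · have hg : Gen fun i => a.rep i - 1 := a.gen_rep.map Primrec.pred.to_comp
    refine Or.inr ⟨mk _ hg, ?_, eq_iff.2 ?_⟩
    · filter_upwards [h, rep_mk hg] with i h1 h2
      rw [h2]; omega
    · filter_upwards [h, rep_mk hg, rep_succ (mk _ hg)] with i h1 h2 h3
      rw [h3, h2]; omega

/-- A failure of induction has a least counterexample in the model, which is neither 0 nor a
successor. -/
lemma genModel_induction (θ : QF) (i : ℕ) (v : Assignment genModel)
    (h0 : θ.Holds (v.setNum i genModel.zero))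
    (hs : ∀ a, θ.Holds (v.setNum i a) → θ.Holds (v.setNum i (genModel.succ a))) (a : GenNum) :
    θ.Holds (v.setNum i a) := by
  -- The characteristic function takes two arguments; the variable `i + 1` serves as a dummy and
  -- keeps its value.
  have hv : ∀ b, ((v.setNum (i + 1) (v.num (i + 1))).setNum i b) = v.setNum i b := fun b => by
    rw [Assignment.setNum_self]
  obtain ⟨χ, hχ, hχ'⟩ := exists_isRec_holds v (i + 1) i (.neg θ)
  have key : ∀ b, (∀ᶠ n in (hyperfilter ℕ : Filter ℕ), (χ ![v.num (i + 1), b]).rep n = 0) ↔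
      ¬ θ.Holds (v.setNum i b) := fun b => by
    rw [← eq_zero_iff, hχ']
    simp only [QF.Holds, Matrix.cons_val_zero, Matrix.cons_val_one, hv]
  obtain ⟨φ, -, p, -, hmin⟩ := hχ.exists_min
  by_contra hcon
  obtain ⟨m, -, -, hm, hlt⟩ := hmin _ a ((key a).2 hcon)
  rw [key] at hm
  rcases genModel_eq_zero_or_succ m with rfl | ⟨b, hb, rfl⟩
  · exact hm h0
  · refine hm (hs b ?_)
    by_contra hb'
    obtain ⟨n, h1, h2⟩ := ((hlt b hb).and ((key b).2 hb')).exists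
    exact h1 h2

theorem genModel_satisfies_PRA2 : genModel.Satisfies PRA2 := by
  refine satisfies_PRA2 genModel (fun a h => ?_) (fun a b h => eq_iff.2 ?_) (fun a h => ?_)
    (fun a b => ?_) (fun j x => eq_iff.2 ?_) (fun f g x => eq_iff.2 ?_) (fun f g x => eq_iff.2 ?_)
    (fun f g a x => eq_iff.2 ?_) genModel_induction (fun p => isRec_lift (computable_eval p))
    (fun n a => isRec_const a) (fun f hf g => IsRec.comp hf fun j => (g j).2)
    (fun f hf g hg => ?_)
  · obtain ⟨i, h1, h2, h3⟩ := (rep_zero.and ((rep_succ a).and (eq_iff.1 h))).exists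
    omega
  · filter_upwards [rep_succ a, rep_succ b, eq_iff.1 h] with i h1 h2 h3
    omega
  · obtain ⟨i, h1, h2⟩ := (rep_zero.and h).exists
    omega
  · rw [eq_iff]
    change (∀ᶠ i in (hyperfilter ℕ : Filter ℕ), _) ↔ (∀ᶠ i in (hyperfilter ℕ : Filter ℕ), _) ∨ _
    rw [← Ultrafilter.eventually_or]
    refine eventually_congr ?_
    filter_upwards [rep_succ b] with i hi
    omega
  · exact rep_lift (computable_eval (.proj j)) x
  · filter_upwards [rep_lift (computable_eval (.comp f g)) x, rep_lift (computable_eval f)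
      fun j => lift (g j).eval (computable_eval (g j)) x,
      tuple_congr fun j => rep_lift (computable_eval (g j)) x] with i h1 h2 h3
    rw [h1, h2, h3]
    rfl
  · filter_upwards [rep_lift (computable_eval (.prec f g)) (Fin.cons genModel.zero x),
      rep_lift (computable_eval f) x, rep_zero] with i h1 h2 h3
    rw [h1, h2, tuple_cons, h3]
    rfl
  · filter_upwards [rep_lift (computable_eval (.prec f g)) (Fin.cons (genModel.succ a) x),
      rep_lift (computable_eval g) (Fin.cons a (Fin.cons
        (lift _ (computable_eval (.prec f g)) (Fin.cons a x)) x)),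
      rep_lift (computable_eval (.prec f g)) (Fin.cons a x), rep_succ a] with i h1 h2 h3 h4
    rw [h1, h2, tuple_cons, tuple_cons, tuple_cons, h3, h4, tuple_cons]
    rfl
  · obtain ⟨h, hh, h1, h2⟩ := IsRec.prec hf hg
    exact ⟨h, hh, fun x => h1 _ x rep_zero, fun a x => h2 a _ x (rep_succ a)⟩

/-- The least witness is found by a search that is uniform in the argument, so choosing it is a
recursive function. -/
theorem genModel_satisfies_QFAC : genModel.Satisfies QFAC := by
  rw [satisfies_QFAC_iff]
  intro θ i j _ _ _ v hv
  obtain ⟨χ, hχ, hχ'⟩ := exists_isRec_holds v i j θ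
  have key : ∀ a b, (∀ᶠ n in (hyperfilter ℕ : Filter ℕ), (χ ![a, b]).rep n = 0) ↔
      θ.Holds ((v.setNum i a).setNum j b) := fun a b => by
    rw [← eq_zero_iff, hχ']
    rfl
  obtain ⟨φ, hφ, p, hp, hmin⟩ := hχ.exists_min
  have hex : ∀ a : GenNum, ∃ m : GenNum,
      (∀ᶠ n in (hyperfilter ℕ : Filter ℕ), m.rep n ∈ φ (p n, a.rep n)) ∧
      θ.Holds ((v.setNum i a).setNum j m) := fun a => by
    obtain ⟨b, hb⟩ := hv a
    obtain ⟨m, h1, -, h2, -⟩ := hmin a b ((key a b).2 hb)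
    exact ⟨m, h1, (key a m).1 h2⟩
  choose F hF hF' using hex
  refine ⟨⟨fun x => F (x 0), IsRec.intro (φ := fun q : ℕ × (Fin 1 → ℕ) => φ (q.1, q.2 0))
    (hφ.comp (Computable.fst.pair ((computable_apply 0).comp Computable.snd))) hp
    fun x => hF (x 0)⟩, fun a => hF' a⟩

theorem genModel_satisfies_RCA0 : genModel.Satisfies RCA0 := by
  rintro θ (h | h)
  · exact genModel_satisfies_PRA2 θ h
  · exact genModel_satisfies_QFAC θ h

/-! ### Failure of the Ramsey principles in the generated model -/

/-- A non-standard number. -/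
noncomputable def nonstandard : GenNum := mk _ Gen.id

/-- The colouring of the numbers of the model with `nonstandard + 1` colours. -/
noncomputable def genColour (a : GenNum) : GenNum :=
  mk _ (nonstandard.gen_rep.map₂ a.gen_rep primrec_colour.to_comp)

lemma rep_genColour (a : GenNum) : ∀ᶠ i in (hyperfilter ℕ : Filter ℕ),
    (genColour a).rep i = colour (nonstandard.rep i) (a.rep i) :=
  rep_mk _

lemma isRec_genColour : IsRec fun x : Fin 1 → GenNum => genColour (x 0) :=
  IsRec.intro (φ := fun q : ℕ × (Fin 1 → ℕ) => Part.some (colour q.1 (q.2 0)))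
    (primrec_colour.to_comp.comp Computable.fst
      ((computable_apply 0).comp Computable.snd)).partrec nonstandard.gen_rep fun x => by
      filter_upwards [rep_genColour (x 0)] with i hi
      exact Part.mem_some_iff.2 hi

/-- Each colour is bounded. -/
lemma exists_bound_genColour (b : GenNum) : ∃ s : GenNum, ∀ a, genModel.lt s a →
    genColour a ≠ b := by
  obtain ⟨j, φ, hφ, hb⟩ := b.gen_rep
  obtain ⟨c, rfl⟩ := Nat.Partrec.Code.exists_code.1 (Partrec.nat_iff.1 hφ)
  refine ⟨mk _ (Gen.of_stageLim (j + 2)), fun a ha hab => ?_⟩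
  -- The index of `b` is a standard number, hence below `n` for almost all `n`. Beyond stage
  -- `stageLim (j + 2)` its approximation equals `b`, which the colour avoids.
  obtain ⟨n, h1, h2, h3, h4, h5, h6, h7, h8⟩ := (hb.and (ha.and ((rep_genColour a).and
    ((eq_iff.1 hab).and ((rep_mk (Gen.of_stageLim (j + 2))).and ((rep_mk Gen.id).and
    ((eventually_gt_hyperfilter (Nat.pair (encode c) j)).and
    (eventually_gt_hyperfilter (encode c))))))))).exists
  rw [h5] at h2
  change nonstandard.rep n = n at h6
  rw [h6, h4] at h3
  exact approx_ne_colour (a.rep n) h7 ((approx_eq h8 h1 h2.le).trans h3)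

theorem genModel_not_satisfies_RT1Fin : ¬ genModel.Satisfies RT1Fin := by
  rw [satisfies_RT1Fin_iff]
  intro h
  obtain ⟨H, -, -, hunb, c, hc⟩ := h (genModel.succ nonstandard) _ isRec_genColour fun x _ => by
    filter_upwards [rep_succ nonstandard, rep_genColour (x 0)] with i h1 h2
    rw [h1, h2]
    exact Nat.lt_succ_of_le (colour_le _ _)
  obtain ⟨s, hs⟩ := exists_bound_genColour c
  obtain ⟨b, hsb, hb⟩ := hunb s
  exact hs b hsb (hc (fun _ => b) (fun i j hij => by omega) fun _ => hb)

/-- In an unbounded recursive set, some two numbers have the same colour. -/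
lemma exists_lt_genColour_eq {H : (Fin 1 → GenNum) → GenNum} (hH : IsRec H)
    (hunb : ∀ a, ∃ b, genModel.lt a b ∧ H (fun _ => b) = genModel.numeral 1) :
    ∃ a b, genModel.lt a b ∧ H (fun _ => a) = genModel.numeral 1 ∧
      H (fun _ => b) = genModel.numeral 1 ∧ genColour a = genColour b := by
  obtain ⟨θ, hθ, p, hp, hval⟩ := hH
  have hmem : ∀ a : GenNum, H (fun _ => a) = genModel.numeral 1 ↔
      ∀ᶠ i in (hyperfilter ℕ : Filter ℕ), 1 ∈ θ (p i, fun _ => a.rep i) := by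
    intro a
    rw [eq_iff]
    refine eventually_congr ?_
    filter_upwards [hval fun _ => a, rep_numeral 1] with i h1 h2
    have h1 : GenNum.rep (H fun _ => a) i ∈ θ (p i, fun _ => a.rep i) := h1
    rw [h2]
    exact ⟨fun h => by rwa [h] at h1, fun h => Part.mem_unique h1 h⟩
  have htot : ∀ b : GenNum, ∀ᶠ i in (hyperfilter ℕ : Filter ℕ), ∀ m ≤ b.rep i,
      (θ (p i, fun _ => m)).Dom := fun b =>
    Gen.forall_le_dom (φ := fun r : ℕ × ℕ => θ (r.1, fun _ => r.2))
      (hθ.comp (Computable.fst.pair (computable_pi fun _ => Computable.snd))) hp (fun x hx => by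
        filter_upwards [hval fun _ => mk x hx, rep_mk hx] with i h1 h2
        have h3 : tuple (fun _ : Fin 1 => mk x hx) i = fun _ => x i := funext fun _ => h2
        rw [h3] at h1
        exact Part.dom_iff_mem.2 ⟨_, h1⟩) b.gen_rep
  -- the least element of the set of a given colour
  let φ : (ℕ × ℕ) × ℕ →. ℕ := fun r => Nat.rfind fun m =>
    (θ (r.1.1, fun _ => m)).map fun v => decide (v = 1 ∧ colour r.1.2 m = r.2)
  have hφ : Partrec φ := by
    refine Partrec.rfind (Partrec.map (f := fun q : ((ℕ × ℕ) × ℕ) × ℕ =>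
      θ (q.1.1.1, fun _ => q.2))
      (g := fun q v => decide (v = 1 ∧ colour q.1.1.2 q.2 = q.1.2)) ?_ ?_).to₂
    · exact hθ.comp ((Computable.fst.comp (Computable.fst.comp Computable.fst)).pair
        (computable_pi fun _ => Computable.snd))
    · refine (PrimrecPred.decide (PrimrecPred.and (Primrec.eq.comp Primrec.snd (Primrec.const 1))
        (Primrec.eq.comp (primrec_colour.comp ?_ ?_) ?_))).to_comp
      · exact Primrec.snd.comp (Primrec.fst.comp (Primrec.fst.comp Primrec.fst))
      · exact Primrec.snd.comp Primrec.fst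
      · exact Primrec.snd.comp (Primrec.fst.comp Primrec.fst)
  have hpN : Gen fun i => (p i, nonstandard.rep i) := hp.pair nonstandard.gen_rep
  -- All least elements of the at most `N + 1` colour classes lie below one number of the model. A
  -- member `b` of the set beyond it shares its colour with a smaller member.
  obtain ⟨B, hB, hbound⟩ := Gen.exists_value_bound hφ hpN nonstandard.gen_rep
  obtain ⟨b, hBb, hb⟩ := hunb (mk B hB)
  have hex : ∀ᶠ i in (hyperfilter ℕ : Filter ℕ),
      ∃ x ∈ φ ((p i, nonstandard.rep i), (genColour b).rep i), x ≤ B i ∧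
        1 ∈ θ (p i, fun _ => x) ∧ colour (nonstandard.rep i) x = (genColour b).rep i := by
    filter_upwards [(hmem b).1 hb, htot b, hbound, rep_genColour b] with i h1 h2 h3 h4
    have htrue : true ∈ (θ (p i, fun _ => b.rep i)).map fun v =>
        decide (v = 1 ∧ colour (nonstandard.rep i) (b.rep i) = (genColour b).rep i) :=
      (Part.mem_map_iff _).2 ⟨1, h1, by simp [h4]⟩
    obtain ⟨x, hx⟩ := Part.dom_iff_mem.1 ((Nat.rfind_dom' (p := fun m =>
      (θ (p i, fun _ => m)).map fun v =>
        decide (v = 1 ∧ colour (nonstandard.rep i) m = (genColour b).rep i))).2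
      ⟨b.rep i, htrue, fun h => h2 _ h⟩)
    obtain ⟨v, hv, hv'⟩ := (Part.mem_map_iff _).1 (Nat.rfind_spec hx)
    have hv'' := of_decide_eq_true hv'
    exact ⟨x, hx, h3 _ (h4.le.trans (colour_le _ _)) _ hx, hv''.1 ▸ hv, hv''.2⟩
  obtain ⟨x, hx, hxφ⟩ := (hpN.pair (genColour b).gen_rep).exists_value hφ
    (hex.mono fun i ⟨x, hx, _⟩ => Part.dom_iff_mem.2 ⟨x, hx⟩)
  have hspec : ∀ᶠ i in (hyperfilter ℕ : Filter ℕ), (mk x hx).rep i ≤ B i ∧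
      1 ∈ θ (p i, fun _ => (mk x hx).rep i) ∧
      colour (nonstandard.rep i) ((mk x hx).rep i) = (genColour b).rep i := by
    filter_upwards [hex, hxφ, rep_mk hx] with i ⟨y, hy, h⟩ h1 h2
    rwa [h2, Part.mem_unique h1 hy]
  refine ⟨mk x hx, b, ?_, (hmem _).2 (hspec.mono fun i h => h.2.1), hb, eq_iff.2 ?_⟩
  · filter_upwards [hspec, hBb, rep_mk hB] with i h1 h2 h3
    omega
  · filter_upwards [hspec, rep_genColour (mk x hx)] with i h1 h2
    rw [h2, h1.2.2]

/-- In an unbounded set, an increasing pair is the beginning of increasing tuples. -/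
lemma exists_increasing_extend {H : (Fin 1 → GenNum) → GenNum}
    (hunb : ∀ a, ∃ b, genModel.lt a b ∧ H (fun _ => b) = genModel.numeral 1) {a b : GenNum}
    (hab : genModel.lt a b) (ha : H (fun _ => a) = genModel.numeral 1)
    (hb : H (fun _ => b) = genModel.numeral 1) (n : ℕ) :
    ∃ x : Fin (n + 2) → GenNum, genModel.Increasing x ∧
      (∀ j, H (fun _ => x j) = genModel.numeral 1) ∧ x 0 = a ∧ x 1 = b := by
  choose f hf hfH using hunb
  let s : ℕ → GenNum := fun i => match i with
    | 0 => a
    | i + 1 => f^[i] b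
  refine ⟨fun i => s i, ?_, fun j => ?_, rfl, rfl⟩
  · rintro ⟨i, hi⟩ ⟨j, hj⟩ hij
    simp only at hij
    subst hij
    cases i with
    | zero => exact hab
    | succ i =>
      simp only [s, Function.iterate_succ_apply']
      exact hf _
  · obtain ⟨j, hj⟩ := j
    match j with
    | 0 => exact ha
    | 1 => exact hb
    | j + 2 =>
      simp only [s, Function.iterate_succ_apply']
      exact hfH _

/-- The colouring compares the colours of the first two entries. A coincidence in the homogeneous
set forces the homogeneous colour to be 1, so every later member `d` has the colour of `a`, although
that colour is bounded. -/
theorem genModel_not_satisfies_RT {n k : ℕ} (hn : 2 ≤ n) (hk : 2 ≤ k) :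
    ¬ genModel.Satisfies (RT n k) := by
  rw [satisfies_RT_iff]
  intro h
  obtain ⟨n, rfl⟩ : ∃ m, n = m + 2 := ⟨n - 2, by omega⟩
  let f : (Fin 2 → ℕ) → ℕ := fun y => if y 0 = y 1 then 1 else 0
  have hf : Computable f := (Primrec.ite (Primrec.eq.comp (primrec_apply 0) (primrec_apply 1))
    (Primrec.const 1) (Primrec.const 0)).to_comp
  have hg : ∀ j : Fin (n + 2), IsRec fun x : Fin (n + 2) → GenNum => genColour (x j) := fun j =>
    IsRec.comp isRec_genColour (g := fun _ x => x j) fun _ => isRec_proj j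
  have hF : IsRec fun x : Fin (n + 2) → GenNum =>
      lift f hf fun j => genColour (x (Fin.castLE (Nat.le_add_left 2 n) j)) :=
    (isRec_lift hf).comp fun j => hg _
  have hrep : ∀ x : Fin (n + 2) → GenNum, ∀ᶠ i in (hyperfilter ℕ : Filter ℕ), (lift f hf fun j =>
      genColour (x (Fin.castLE (Nat.le_add_left 2 n) j))).rep i =
      if (genColour (x 0)).rep i = (genColour (x 1)).rep i then 1 else 0 := fun x =>
    rep_lift hf _
  obtain ⟨H, hH, -, hunb, c, hc⟩ := h _ hF fun x _ => by
    filter_upwards [hrep x, rep_numeral k] with i h1 h2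
    rw [h1, h2]
    split_ifs <;> omega
  obtain ⟨a, b, hab, ha, hb, hcol⟩ := exists_lt_genColour_eq hH hunb
  have hone : ∀ᶠ i in (hyperfilter ℕ : Filter ℕ), c.rep i = 1 := by
    obtain ⟨x, hx, hxH, hx0, hx1⟩ := exists_increasing_extend hunb hab ha hb n
    rw [← hc x hx hxH]
    filter_upwards [hrep x] with i hi
    rw [hi, hx0, hx1, hcol]
    simp
  obtain ⟨s, hs⟩ := exists_bound_genColour (genColour a)
  -- The larger of two members of the set, one beyond `a` and one beyond the bound `s`.
  obtain ⟨d, hd, hdH⟩ : ∃ d, (genModel.lt a d ∧ genModel.lt s d) ∧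
      H (fun _ => d) = genModel.numeral 1 := by
    obtain ⟨d, hd, hdH⟩ := hunb a
    obtain ⟨d', hd', hdH'⟩ := hunb s
    rcases genModel_lt_total d d' with h | h | h
    · refine ⟨d', ⟨?_, hd'⟩, hdH'⟩
      filter_upwards [hd, h] with i h1 h2 using h1.trans h2
    · exact ⟨d, ⟨hd, h ▸ hd'⟩, hdH⟩
    · refine ⟨d, ⟨hd, ?_⟩, hdH⟩
      filter_upwards [hd', h] with i h1 h2 using h1.trans h2
  obtain ⟨x, hx, hxH, hx0, hx1⟩ := exists_increasing_extend hunb hd.1 ha hdH n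
  refine hs d hd.2 (eq_iff.2 ?_)
  have hcx := hc x hx hxH
  filter_upwards [hone, hrep x] with i h1 h2
  rw [hcx, h1, hx0, hx1] at h2
  by_contra hne
  rw [if_neg (Ne.symm hne)] at h2
  exact one_ne_zero h2

end SecondOrderPRA

theorem mainTheorem5 :
    (¬ SecondOrderPRA.ImpliesOver SecondOrderPRA.PRA2 SecondOrderPRA.RT1Fin SecondOrderPRA.RCA0 ∧
      ¬ SecondOrderPRA.ImpliesOver SecondOrderPRA.PRA2 SecondOrderPRA.RCA0 SecondOrderPRA.RT1Fin) ∧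
    ∀ n k : ℕ, 2 ≤ n → 2 ≤ k →
      (¬ SecondOrderPRA.ImpliesOver SecondOrderPRA.PRA2 (SecondOrderPRA.RT n k)
          SecondOrderPRA.RCA0 ∧
        ¬ SecondOrderPRA.ImpliesOver SecondOrderPRA.PRA2 SecondOrderPRA.RCA0
          (SecondOrderPRA.RT n k)) := by
  open SecondOrderPRA in
  have hA : ∀ S : Theory, majorizedModel.Satisfies S → ¬ ImpliesOver PRA2 S RCA0 := fun S hS h =>
    majorizedModel_not_satisfies_QFAC fun θ hθ =>
      h majorizedModel majorizedModel_satisfies_PRA2 hS θ (Or.inr hθ)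
  open SecondOrderPRA in
  have hB : ∀ T : Theory, ¬ genModel.Satisfies T → ¬ ImpliesOver PRA2 RCA0 T := fun T hT h =>
    hT (h genModel genModel_satisfies_PRA2 genModel_satisfies_RCA0)
  refine ⟨⟨hA _ ?_, hB _ SecondOrderPRA.genModel_not_satisfies_RT1Fin⟩, fun n k hn hk =>
    ⟨hA _ ?_, hB _ (SecondOrderPRA.genModel_not_satisfies_RT hn hk)⟩⟩
  · exact SecondOrderPRA.satisfies_RT1Fin_iff.2 fun a => SecondOrderPRA.majorizedModel_ramsey 1 a
  · rw [SecondOrderPRA.satisfies_RT_iff, SecondOrderPRA.majorizedModel_numeral]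
    exact SecondOrderPRA.majorizedModel_ramsey n k
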